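/- **Setting.** For a partition $P$ of $[n]=\{1,\dots,n\}$, the arcs of $P$ are the pairs $(a,b)$, $a<b$, of consecutive elements (in numerical order) of a block; $a$ is the left-hand and $b$ the right-hand endpoint of the arc. For $S,T\subseteq[n]$ with $|S|=|T|$, let $P_n(S,T)$ be the set of partitions of $[n]$ whose set of minimal block elements is $S$ and whose set of maximal block elements is $T$. Two arcs $(i_1,j_1),(i_2,j_2)$ cross if $i_1<i_2<j_1<j_2$ or $i_2<i_1<j_2<j_1$. **The map $\phi$ on matchings.** Let $M$ be a perfect matching of a finite linearly ordered set, given by its arcs (pairs $(a,b)$ with $a<b$). Define $\phi(M)$ by recursion on the number of arcs, with $\phi(\emptyset)=\emptyset$. If $M\neq\emptyset$, let $t$ be the largest vertex, $(i,t)$ its arc, and $N=\phi(M\setminus\{(i,t)\})$. Call an arc $(a,b)$ with $a\ne i$ large if $a<i$ and small if $a>i$. Let $\mathcal R$ be the set of right-hand endpoints $j$ of $N$ with $i<j<t$. Let $e_L=(e_L^l,e_L^r)$ be the large arc of $N$ with the biggest right-hand endpoint in $\mathcal R$, and $e_S=(e_S^l,e_S^r)$ the small arc of $N$ with the smallest left-hand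 endpoint among those crossing $e_L$. If $e_S$ exists, put $\mathcal R_1=\{j\in\mathcal R: e_S^l<j\le e_S^r\}$ and $\mathcal R_2=\{j\in\mathcal R: j<e_S^l\}$. If $e_L$ exists but $e_S$ does not, put $\mathcal R_1=\emptyset$ and $\mathcal R_2=\{j\in\mathcal R: j\le e_L^r\}$. If $e_L$ does not exist, put $\mathcal R_1=\mathcal R_2=\emptyset$. Starting with the matching $N$, carry out the following two algorithms in turn; at each moment $(i_k,j_k)$ denotes the arc of the current matching with right-hand endpoint $j_k$. *Algorithm I* (if $\mathcal R_1\ne\emptyset$). Put $j_1=e_S^r$, and let $j_2$ run through the elements of $\mathcal R_1$ smaller than $e_S^r$ in decreasing order. For each $j_2$: (B1) if $(i_2,j_2)$ is large, change $(i_1,j_1),(i_2,j_2)$ to $(i_1,j_2),(i_2,j_1)$ and then set $j_1:=j_2$; (B2.1) if $(i_2,j_2)$ is small and no right-hand endpoint lies between $i_1$ and $i_2$, set $j_1:=j_2$; (B2.2) if $(i_2,j_2)$ is small, $i_1<i_2$ and some right-hand endpoint lies between $i_1$ and $i_2$, do nothing; (B2.3) if $(i_2,j_2)$ is small, $i_2<i_1$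 and some right-hand endpoint lies between $i_1$ and $i_2$, take the smallest $j_3>j_1$ whose arc $(i_3,j_3)$ is large, change $(i_1,j_1),(i_2,j_2),(i_3,j_3)$ to $(i_1,j_2),(i_2,j_3),(i_3,j_1)$, and then set $j_1:=j_2$. *Algorithm II* (if $\mathcal R_2\ne\emptyset$). Let $t_0=\max\mathcal R_2$, with arc $(i_0,t_0)$. If this arc is small, take the smallest $t_1>t_0$ whose arc $(i_1,t_1)$ is large and change $(i_0,t_0),(i_1,t_1)$ to $(i_0,t_1),(i_1,t_0)$. Then put $j_1=t_0$, and let $j_2$ run through the elements of $\mathcal R$ smaller than $t_0$ in decreasing order. For each $j_2$: if $(i_2,j_2)$ is small, change $(i_1,j_1),(i_2,j_2)$ to $(i_1,j_2),(i_2,j_1)$; in either case then set $j_1:=j_2$. If $M_2$ is the resulting matching, put $\phi(M)=M_2\cup\{(i,t)\}$. **The map $\phi$ on partitions.** For a partition $P$ of $[n]$, let $M(P)$ be the matching obtained from the arcs of $P$ by replacing each vertex $i\notin S\cup T$ (where $S,T$ are the sets of minimal and maximal block elements of $P$) by two neighbouring vertices $i^0<i^1$, the arc ending at $i$ being attached to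 $i^0$ and the arc starting at $i$ to $i^1$, and by removing the isolated vertices. Then $\phi(P)$ is the partition obtained from $\phi(M(P))$ by identifying $i^0$ with $i^1$ for all such $i$ and adding back the isolated vertices, the blocks being the connected components. **Theorem.** Let $S,T\subseteq[n]$ with $|S|=|T|$. The map $\phi$ is well defined on $P_n(S,T)$: all arcs sought in the algorithms exist, and every exchange of arcs produces pairs $(a,b)$ with $a<b$. For every $P\in P_n(S,T)$ we have $\phi(P)\in P_n(S,T)$ and $M(\phi(P))=\phi(M(P))$, and $\phi(P)$ has the same set of left-hand endpoints and the same set of right-hand endpoints as $P$. The map $\phi:P_n(S,T)\to P_n(S,T)$ is a bijection. -/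

import Mathlib

namespace ArcDiagram

section Matching

variable {V : Type*} [LinearOrder V]

/-- The smallest element of a finite set, if there is one. -/
def minOpt (s : Finset V) : Option V :=
  if h : s.Nonempty then some (s.min' h) else none

/-- The largest element of a finite set, if there is one. -/
def maxOpt (s : Finset V) : Option V :=
  if h : s.Nonempty then some (s.max' h) else none

/-- The left-hand endpoints of a set of arcs; an arc is a pair `(i, j)` with `i < j`. -/
def lefts (M : Finset (V × V)) : Finset V := M.image Prod.fst

/-- The right-hand endpoints of a set of arcs. -/
def rights (M : Finset (V × V)) : Finset V := M.image Prod.snd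

/-- The left-hand endpoint of the arc of `M` that ends at `j` (`none` if there is no such arc). -/
def leftOf (M : Finset (V × V)) (j : V) : Option V :=
  minOpt (lefts (M.filter fun e => e.2 = j))

/-- The right-hand endpoint of the arc of `M` that starts at `i` (`none` if there is none). -/
def rightOf (M : Finset (V × V)) (i : V) : Option V :=
  minOpt (rights (M.filter fun e => e.1 = i))

/-- Two arcs cross: `i₁ < i₂ < j₁ < j₂` for one of the two orders of the arcs. -/
def Crosses (e f : V × V) : Prop :=
  (e.1 < f.1 ∧ f.1 < e.2 ∧ e.2 < f.2) ∨ (f.1 < e.1 ∧ e.1 < f.2 ∧ f.2 < e.2)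

instance (e f : V × V) : Decidable (Crosses e f) := by
  unfold Crosses; infer_instance

/-- Some right-hand endpoint of `M` lies strictly between `a` and `b` (in either order). -/
def HasRightBetween (M : Finset (V × V)) (a b : V) : Prop :=
  ∃ j ∈ rights M, min a b < j ∧ j < max a b

instance (M : Finset (V × V)) (a b : V) : Decidable (HasRightBetween M a b) := by
  unfold HasRightBetween; infer_instance

/-- Change the arcs `old` of `M` to the arcs `new`. This is undefined if one of the new pairs
is not an arc, i.e. if its first entry is not smaller than its second entry. -/
def exchange (M old new : Finset (V × V)) : Option (Finset (V × V)) :=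
  if ∀ e ∈ new, e.1 < e.2 then some ((M \ old) ∪ new) else none

/-! In what follows `(i, t)` is the removed last arc, and `N` is a matching on the remaining
vertices. An arc `(a, b)` of `N` is large if `a < i` and small if `i < a`. -/

/-- `R`: the right-hand endpoints of `N` between `i` and `t`. -/
def regionR (N : Finset (V × V)) (i t : V) : Finset V :=
  (rights N).filter fun j => i < j ∧ j < t

/-- The critical large arc: the large arc with the biggest right-hand endpoint in `R`. -/
def criticalLarge (N : Finset (V × V)) (i t : V) : Option (V × V) := do
  let r ← maxOpt (rights (N.filter fun e => e.1 < i ∧ e.2 ∈ regionR N i t))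
  let l ← leftOf N r
  some (l, r)

/-- The critical small arc: the small arc with the smallest left-hand endpoint which crosses
the critical large arc. -/
def criticalSmall (N : Finset (V × V)) (i t : V) : Option (V × V) := do
  let eL ← criticalLarge N i t
  let l ← minOpt (lefts (N.filter fun e => i < e.1 ∧ Crosses e eL))
  let r ← rightOf N l
  some (l, r)

/-- `R₁`. -/
def regionR1 (N : Finset (V × V)) (i t : V) : Finset V :=
  match criticalSmall N i t with
  | none => ∅
  | some eS => (regionR N i t).filter fun j => eS.1 < j ∧ j ≤ eS.2

/-- `R₂`. -/
def regionR2 (N : Finset (V × V)) (i t : V) : Finset V :=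
  match criticalLarge N i t with
  | none => ∅
  | some eL =>
    match criticalSmall N i t with
    | none => (regionR N i t).filter fun j => j ≤ eL.2
    | some eS => (regionR N i t).filter fun j => j < eS.1

/-- The right-hand endpoint, nearest to the right of `j`, of a large arc of `M`. -/
def nextLarge (M : Finset (V × V)) (i j : V) : Option V :=
  minOpt (rights (M.filter fun e => e.1 < i ∧ j < e.2))

/-- The vertices of `s` to the left of `j`, listed from right to left. -/
def leftwards (s : Finset V) (j : V) : List V :=
  (s.filter fun k => k < j).sort (· ≥ ·)

/-- One pass through step (B) of Algorithm I. The state is the current matching together with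
the position of the first pointer; `j₂` is the position of the second pointer. The four
branches are (B1), (B2.1), (B2.2), (B2.3). -/
def stepI (i : V) (st : Finset (V × V) × V) (j₂ : V) : Option (Finset (V × V) × V) := do
  let M := st.1
  let j₁ := st.2
  let i₁ ← leftOf M j₁
  let i₂ ← leftOf M j₂
  if i₂ < i then
    let M' ← exchange M {(i₁, j₁), (i₂, j₂)} {(i₁, j₂), (i₂, j₁)}
    some (M', j₂)
  else if ¬ HasRightBetween M i₁ i₂ then
    some (M, j₂)
  else if i₁ < i₂ then
    some (M, j₁)
  else
    let j₃ ← nextLarge M i j₁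
    let i₃ ← leftOf M j₃
    let M' ← exchange M {(i₁, j₁), (i₂, j₂), (i₃, j₃)} {(i₁, j₂), (i₂, j₃), (i₃, j₁)}
    some (M', j₂)

/-- Algorithm I: the first pointer starts at the right-hand endpoint of the critical small arc,
the second one runs through the other vertices of `R₁` from right to left. -/
def algorithmI (N : Finset (V × V)) (i t : V) : Option (Finset (V × V)) :=
  match criticalSmall N i t with
  | none => some N
  | some eS => do
    let st ← (leftwards (regionR1 N i t) eS.2).foldlM (stepI i) (N, eS.2)
    some st.1

/-- The pre-processing step ("borrowing") of Algorithm II at the vertex `t₀`. -/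
def borrow (M : Finset (V × V)) (i t₀ : V) : Option (Finset (V × V)) := do
  let i₀ ← leftOf M t₀
  if i₀ < i then
    some M
  else
    let t₁ ← nextLarge M i t₀
    let i₁ ← leftOf M t₁
    exchange M {(i₀, t₀), (i₁, t₁)} {(i₀, t₁), (i₁, t₀)}

/-- One pass through steps (B') and (C') of Algorithm II. -/
def stepII (i : V) (st : Finset (V × V) × V) (j₂ : V) : Option (Finset (V × V) × V) := do
  let M := st.1
  let j₁ := st.2
  let i₁ ← leftOf M j₁
  let i₂ ← leftOf M j₂
  if i₂ < i then
    some (M, j₂)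
  else
    let M' ← exchange M {(i₁, j₁), (i₂, j₂)} {(i₁, j₂), (i₂, j₁)}
    some (M', j₂)

/-- Algorithm II, applied to the current matching `M`; the regions are those of `N`. -/
def algorithmII (N : Finset (V × V)) (i t : V) (M : Finset (V × V)) :
    Option (Finset (V × V)) :=
  match maxOpt (regionR2 N i t) with
  | none => some M
  | some t₀ => do
    let M₀ ← borrow M i t₀
    let st ← (leftwards (regionR N i t) t₀).foldlM (stepII i) (M₀, t₀)
    some st.1

/-- The map `φ` on matchings with `m` arcs, by recursion on `m`. -/
def phiAux : ℕ → Finset (V × V) → Option (Finset (V × V))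
  | 0, M => some M
  | m + 1, M => do
    let t ← maxOpt (rights M)
    let i ← leftOf M t
    let N ← phiAux m (M.erase (i, t))
    let M₁ ← algorithmI N i t
    let M₂ ← algorithmII N i t M₁
    some (insert (i, t) M₂)

/-- The map `φ` on matchings of a linearly ordered vertex set, given by their arcs. The value is
`none` if some step of the algorithms cannot be carried out. -/
def phiMatching (M : Finset (V × V)) : Option (Finset (V × V)) := phiAux M.card M

end Matching

section Partition

variable {n : ℕ}

/-- Partitions of an `n`-element chain, with `Fin n` in place of `{1, …, n}`. -/
abbrev SetPartition (n : ℕ) := Finpartition (Finset.univ : Finset (Fin n))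

/-- The minimal block elements. -/
def minElems (P : SetPartition n) : Finset (Fin n) :=
  Finset.univ.filter fun x => ∃ B ∈ P.parts, x ∈ B ∧ ∀ y ∈ B, x ≤ y

/-- The maximal block elements. -/
def maxElems (P : SetPartition n) : Finset (Fin n) :=
  Finset.univ.filter fun x => ∃ B ∈ P.parts, x ∈ B ∧ ∀ y ∈ B, y ≤ x

/-- `P_n(S, T)`. -/
def partitionsST (S T : Finset (Fin n)) : Set (SetPartition n) :=
  {P | minElems P = S ∧ maxElems P = T}

/-- The arcs of the standard representation: pairs of consecutive elements of a block. -/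
def arcs (P : SetPartition n) : Finset (Fin n × Fin n) :=
  Finset.univ.filter fun e =>
    ∃ B ∈ P.parts, e.1 ∈ B ∧ e.2 ∈ B ∧ e.1 < e.2 ∧ ∀ x ∈ B, ¬ (e.1 < x ∧ x < e.2)

/-- The vertices of the matching `M(P)`: `i⁰ = (i, 0)` and `i¹ = (i, 1)`, in lexicographic order.
A vertex that is only a right-hand endpoint of `P` is written as `(i, 0)`, and one that is only
a left-hand endpoint as `(i, 1)`; this does not affect the order of the vertices. -/
abbrev SplitVertex (n : ℕ) := Fin n ×ₗ Fin 2

/-- The matching `M(P)`: an arc `(a, b)` of `P` becomes `(a¹, b⁰)`. -/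
def toMatching (P : SetPartition n) : Finset (SplitVertex n × SplitVertex n) :=
  (arcs P).image fun e => (toLex (e.1, 1), toLex (e.2, 0))

open Classical in
/-- Identify `i⁰` and `i¹` for every `i`, and add back the isolated vertices: the blocks are the
connected components of the resulting graph on all `n` vertices. -/
noncomputable def ofMatching (M : Finset (SplitVertex n × SplitVertex n)) : SetPartition n :=
  Finpartition.ofSetoid
    (Relation.EqvGen.setoid fun a b : Fin n =>
      ∃ e ∈ M, (ofLex e.1).1 = a ∧ (ofLex e.2).1 = b)

/-- The map `φ` on set partitions. -/
noncomputable def phi (P : SetPartition n) : Option (SetPartition n) :=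
  (phiMatching (toMatching P)).map ofMatching

end Partition

end ArcDiagram

namespace ArcDiagram

section Matching

variable {V : Type*} [LinearOrder V]

/-! ### Extremal elements and leftward lists -/

/-! A matching is encoded by the function `σ` that sends each right-hand endpoint to the left-hand
endpoint of its arc and fixes all other vertices. Every change of arcs then permutes values of `σ`,
so both endpoint sets persist. Since the set of partitions is finite, injectivity suffices. The arc
`(i, t)` is put back unchanged, so the output reveals `i`; by induction it is enough that for fixed
`K`, `L`, `i` the two algorithms together are injective (`Outcome.injective`).

Algorithm II sweeps from right to left: a vertex with a small arc borrows the nearest large arc on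
its right. Beforehand, among the arcs ending further right and starting before a bound `d`, the
first is large (`LargeFirst`); after a genuine borrowing it is small. Hence each step can be undone
(`borrowMap_injective`).

In Algorithm I the pointer always carries an arc starting in the gap between the two consecutive
vertices `d < f` around the start of the critical small arc. Meeting an arc that starts before `d`,
it swaps, and borrows if that arc is small. The branch taken and the old pointer can be read off
afterwards (`RotateInv.step_injective`).

It remains to recover the case and its parameters. A sweep leaves no tight arc ending at or before
`d`. Algorithm I ends with a tight arc at `f`, so `f` is the first vertex with a tight arc and `d`
its predecessor; the start of Algorithm I may be taken to be the last vertex whose arc starts before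
`f`, and the set of such vertices never changes. With no critical small arc, no arc passes over `d`,
which separates that case from the crossing one (`noSmall_crossing_false`). -/

theorem minOpt_eq_some {s : Finset V} {m : V} (hm : m ∈ s) (h : ∀ k ∈ s, m ≤ k) :
    minOpt s = some m := by
  have hs : s.Nonempty := ⟨m, hm⟩
  rw [minOpt, dif_pos hs, Option.some_inj]
  exact le_antisymm (s.min'_le m hm) (s.le_min' hs m h)

theorem maxOpt_eq_some {s : Finset V} {m : V} (hm : m ∈ s) (h : ∀ k ∈ s, k ≤ m) :
    maxOpt s = some m := by
  have hs : s.Nonempty := ⟨m, hm⟩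
  rw [maxOpt, dif_pos hs, Option.some_inj]
  exact le_antisymm (s.max'_le hs m h) (s.le_max' m hm)

theorem minOpt_empty : minOpt (∅ : Finset V) = none := by simp [minOpt]

theorem maxOpt_empty : maxOpt (∅ : Finset V) = none := by simp [maxOpt]

theorem leftwards_eq_nil {s : Finset V} {j : V} (h : ∀ k ∈ s, ¬ k < j) : leftwards s j = [] := by
  rw [leftwards, Finset.filter_false_of_mem h]
  simp

theorem leftwards_eq_cons {s : Finset V} {j m : V} (hm : m ∈ s) (hj : m < j)
    (h : ∀ k ∈ s, k < j → k ≤ m) : leftwards s j = m :: leftwards s m := by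
  have hins : s.filter (fun k => k < j) = insert m (s.filter fun k => k < m) := by
    ext k
    simp only [Finset.mem_filter, Finset.mem_insert]
    grind
  rw [leftwards, hins, Finset.sort_insert]
  · rfl
  · intro b hb
    exact (Finset.mem_filter.1 hb).2.le
  · simp

theorem leftwards_congr {s s' : Finset V} {j : V}
    (h : ∀ k, k < j → (k ∈ s ↔ k ∈ s')) : leftwards s j = leftwards s' j := by
  unfold leftwards
  congr 1
  ext k
  simp only [Finset.mem_filter]
  grind

/-- This is the induction scheme for folds over `leftwards s j`; in its uses the state of the fold
is generalized. -/
theorem leftwards_induction (s : Finset V) {P : V → Prop}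
    (base : ∀ j, (∀ k ∈ s, ¬ k < j) → P j)
    (step : ∀ j m, m ∈ s → m < j → (∀ k ∈ s, k < j → k ≤ m) → P m → P j) (j : V) : P j := by
  induction hc : (s.filter fun k => k < j).card using Nat.strong_induction_on generalizing j with
  | _ c ih =>
    by_cases hne : (s.filter fun k => k < j).Nonempty
    · have hm := Finset.max'_mem _ hne
      have hle := Finset.le_max' (s.filter fun k => k < j)
      set m := (s.filter fun k => k < j).max' hne
      rw [Finset.mem_filter] at hm
      refine step j m hm.1 hm.2 (fun k hk hkj => hle k (by simp [hk, hkj])) ?_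
      refine ih _ ?_ m rfl
      rw [← hc]
      refine Finset.card_lt_card ⟨fun k hk => ?_, fun hsub => ?_⟩
      · rw [Finset.mem_filter] at hk ⊢
        exact ⟨hk.1, hk.2.trans hm.2⟩
      · have := hsub (Finset.mem_filter.2 hm)
        simp at this
    · refine base j fun k hk hkj => hne ⟨k, by simp [hk, hkj]⟩

/-! ### Matchings as graphs of functions -/

/-- The set of arcs `(σ k, k)` with right-hand endpoints `k ∈ K`. -/
def arcsOf (K : Finset V) (σ : V → V) : Finset (V × V) := K.image fun k => (σ k, k)

/-- `σ` assigns to the right-hand endpoints `K` of a matching the left-hand endpoints `L`. -/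
structure ArcMap (K L : Finset V) (σ : V → V) : Prop where
  lt : ∀ k ∈ K, σ k < k
  image_eq : K.image σ = L
  injOn : ∀ k ∈ K, ∀ k' ∈ K, σ k = σ k' → k = k'
  off : ∀ k, k ∉ K → σ k = k
  notMem : ∀ k ∈ K, σ k ∉ K

theorem ArcMap.mem {K L : Finset V} {σ : V → V} (h : ArcMap K L σ) {k : V} (hk : k ∈ K) :
    σ k ∈ L := h.image_eq ▸ Finset.mem_image_of_mem σ hk

variable {K L : Finset V} {σ τ : V → V}

theorem mem_arcsOf {e : V × V} : e ∈ arcsOf K σ ↔ e.2 ∈ K ∧ σ e.2 = e.1 := by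
  obtain ⟨a, b⟩ := e
  simp only [arcsOf, Finset.mem_image, Prod.mk.injEq]
  constructor
  · rintro ⟨k, hk, rfl, rfl⟩
    exact ⟨hk, rfl⟩
  · rintro ⟨hb, rfl⟩
    exact ⟨b, hb, rfl, rfl⟩

/-- The normalization `off` is what makes the encoding faithful. -/
theorem arcsOf_inj (hσ : ArcMap K L σ) {L' : Finset V} (hτ : ArcMap K L' τ)
    (h : arcsOf K σ = arcsOf K τ) : σ = τ := by
  funext k
  by_cases hk : k ∈ K
  · have : (σ k, k) ∈ arcsOf K τ := h ▸ mem_arcsOf.2 ⟨hk, rfl⟩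
    exact (mem_arcsOf.1 this).2.symm
  · rw [hσ.off k hk, hτ.off k hk]

theorem rights_filter_arcsOf (p : V × V → Prop) [DecidablePred p] :
    rights ((arcsOf K σ).filter p) = K.filter fun k => p (σ k, k) := by
  ext k
  simp only [rights, Finset.mem_image, Finset.mem_filter, mem_arcsOf]
  constructor
  · rintro ⟨⟨a, b⟩, ⟨⟨hb, hab⟩, hp⟩, rfl⟩
    dsimp only at hab
    subst hab
    exact ⟨hb, hp⟩
  · rintro ⟨hk, hp⟩
    exact ⟨(σ k, k), ⟨⟨hk, rfl⟩, hp⟩, rfl⟩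

theorem lefts_filter_arcsOf (p : V × V → Prop) [DecidablePred p] :
    lefts ((arcsOf K σ).filter p) = (K.filter fun k => p (σ k, k)).image σ := by
  ext a
  simp only [lefts, Finset.mem_image, Finset.mem_filter, mem_arcsOf]
  constructor
  · rintro ⟨⟨a, b⟩, ⟨⟨hb, hab⟩, hp⟩, rfl⟩
    dsimp only at hab
    subst hab
    exact ⟨b, ⟨hb, hp⟩, rfl⟩
  · rintro ⟨k, ⟨hk, hp⟩, rfl⟩
    exact ⟨(σ k, k), ⟨⟨hk, rfl⟩, hp⟩, rfl⟩

theorem rights_arcsOf : rights (arcsOf K σ) = K := by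
  have := rights_filter_arcsOf (K := K) (σ := σ) (fun _ => True)
  simpa using this

theorem lefts_arcsOf : lefts (arcsOf K σ) = K.image σ := by
  have := lefts_filter_arcsOf (K := K) (σ := σ) (fun _ => True)
  simpa using this

theorem leftOf_arcsOf {j : V} (hj : j ∈ K) : leftOf (arcsOf K σ) j = some (σ j) := by
  rw [leftOf, lefts_filter_arcsOf]
  apply minOpt_eq_some <;> grind

theorem ArcMap.rightOf_arcsOf (h : ArcMap K L σ) {j : V} (hj : j ∈ K) :
    rightOf (arcsOf K σ) (σ j) = some j := by
  have := h.injOn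
  rw [rightOf, rights_filter_arcsOf]
  apply minOpt_eq_some <;> grind

theorem hasRightBetween_arcsOf {a b : V} :
    HasRightBetween (arcsOf K σ) a b ↔ ∃ k ∈ K, min a b < k ∧ k < max a b := by
  rw [HasRightBetween, rights_arcsOf]

/-! ### Exchanging arcs -/

/-- Exchange the values of `σ` at `a` and `b`. -/
def exch (σ : V → V) (a b : V) : V → V :=
  fun k => if k = a then σ b else if k = b then σ a else σ k

theorem exch_exch (σ : V → V) (a b : V) : exch (exch σ a b) a b = σ := by
  funext k
  simp only [exch]
  grind

theorem exch_injective {a b : V} (h : exch σ a b = exch τ a b) : σ = τ := by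
  rw [← exch_exch σ a b, h, exch_exch]

theorem ArcMap.exch (h : ArcMap K L σ) {a b : V} (ha : a ∈ K) (hb : b ∈ K) (hab : σ a < b)
    (hba : σ b < a) : ArcMap K L (exch σ a b) := by
  obtain ⟨h1, h2, h3, h4, h5⟩ := h
  refine ⟨?_, ?_, ?_, ?_, ?_⟩
  · intro k hk; simp only [ArcDiagram.exch]; grind
  · rw [← h2]
    ext x
    simp only [Finset.mem_image, ArcDiagram.exch]
    constructor
    · rintro ⟨k, hk, rfl⟩; grind
    · rintro ⟨k, hk, rfl⟩
      by_cases hka : k = a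
      · exact ⟨b, hb, by grind⟩
      · by_cases hkb : k = b
        · exact ⟨a, ha, by grind⟩
        · exact ⟨k, hk, by grind⟩
  · intro k hk k' hk'; simp only [ArcDiagram.exch]; grind
  · intro k hk; simp only [ArcDiagram.exch]; grind
  · intro k hk; simp only [ArcDiagram.exch]; grind

theorem exchange_two {a b : V} (ha : a ∈ K) (hb : b ∈ K) (hne : a ≠ b) (hab : σ a < b)
    (hba : σ b < a) :
    exchange (arcsOf K σ) {(σ a, a), (σ b, b)} {(σ a, b), (σ b, a)} =
      some (arcsOf K (exch σ a b)) := by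
  rw [exchange, if_pos (by simp [hab, hba]), Option.some_inj]
  ext ⟨x, k⟩
  simp only [Finset.mem_union, Finset.mem_sdiff, Finset.mem_insert, Finset.mem_singleton,
    mem_arcsOf, Prod.mk.injEq, exch]
  grind

/-- The three-arc change of (B2.3) is the swap of (B1) followed by a borrowing at the old pointer,
so both branches can be treated as one. -/
theorem exchange_three {a b c : V} (ha : a ∈ K) (hb : b ∈ K) (hc : c ∈ K) (hab : a ≠ b)
    (hac : a ≠ c) (hbc : b ≠ c) (h1 : σ a < b) (h2 : σ b < c) (h3 : σ c < a) :
    exchange (arcsOf K σ) {(σ a, a), (σ b, b), (σ c, c)} {(σ a, b), (σ b, c), (σ c, a)} =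
      some (arcsOf K (exch (exch σ a b) a c)) := by
  rw [exchange, if_pos (by simp [h1, h2, h3]), Option.some_inj]
  ext ⟨x, k⟩
  simp only [Finset.mem_union, Finset.mem_sdiff, Finset.mem_insert, Finset.mem_singleton,
    mem_arcsOf, Prod.mk.injEq, exch]
  grind

/-! ### Borrowing a large arc -/

/-- If the arc at `k` is not large, exchange it with the next large arc to the right. -/
def borrowMap (K : Finset V) (i : V) (σ : V → V) (k : V) : V → V :=
  if σ k < i then σ else
    match minOpt (K.filter fun t => σ t < i ∧ k < t) with
    | none => σ
    | some t => exch σ k t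

theorem borrowMap_large {i k : V} (h : σ k < i) : borrowMap K i σ k = σ := if_pos h

theorem nextLarge_arcsOf {i k t : V} (ht : t ∈ K) (hti : σ t < i) (hkt : k < t)
    (hmin : ∀ t' ∈ K, σ t' < i → k < t' → t ≤ t') : nextLarge (arcsOf K σ) i k = some t := by
  rw [nextLarge, rights_filter_arcsOf]
  apply minOpt_eq_some <;> grind

theorem borrowMap_small {i k t : V} (h : ¬ σ k < i) (ht : t ∈ K) (hti : σ t < i) (hkt : k < t)
    (hmin : ∀ t' ∈ K, σ t' < i → k < t' → t ≤ t') : borrowMap K i σ k = exch σ k t := by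
  have : minOpt (K.filter fun t => σ t < i ∧ k < t) = some t := by
    apply minOpt_eq_some <;> grind
  rw [borrowMap, if_neg h, this]

theorem exists_nextLarge {i k : V} (h : ∃ t ∈ K, σ t < i ∧ k < t) :
    ∃ t ∈ K, σ t < i ∧ k < t ∧ ∀ t' ∈ K, σ t' < i → k < t' → t ≤ t' := by
  obtain ⟨t, ht, h1, h2⟩ := h
  have hne : (K.filter fun t => σ t < i ∧ k < t).Nonempty := ⟨t, by simp [ht, h1, h2]⟩
  have hm := Finset.min'_mem _ hne
  have hle := Finset.min'_le (K.filter fun t => σ t < i ∧ k < t)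
  rw [Finset.mem_filter] at hm
  exact ⟨_, hm.1, hm.2.1, hm.2.2, fun t' ht' h h' => hle t' (by simp [ht', h, h'])⟩

/-- Among the arcs at the right of `k` that start before `d`, the first one is large. -/
def LargeFirst (K : Finset V) (i d : V) (σ : V → V) (k : V) : Prop :=
  ∀ k' ∈ K, k < k' → i < σ k' → σ k' < d → ∃ k'' ∈ K, k < k'' ∧ k'' < k' ∧ σ k'' < i

/-- Borrowing for `τ` puts its small arc at `t`. As `σ` is the result, `LargeFirst` gives it a large
arc strictly between `k` and `t`; that arc belongs to `τ` too, so `t` was not the next large arc. -/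
theorem borrowMap_large_ne_small {i d k : V} (hσi : σ k < i) (hτk : τ k < d) (hτi : i < τ k)
    (hτ : ∃ t ∈ K, τ t < i ∧ k < t) (hσ' : LargeFirst K i d σ k)
    (h : borrowMap K i σ k = borrowMap K i τ k) : False := by
  obtain ⟨t, ht, hti, hkt, hmin⟩ := exists_nextLarge hτ
  rw [borrowMap_large hσi, borrowMap_small hτi.not_gt ht hti hkt hmin] at h
  subst h
  obtain ⟨u, hu, h1, h2, h3⟩ := hσ' t ht hkt (by simp only [exch]; grind)
    (by simp only [exch]; grind)
  simp only [exch] at h3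
  grind

/-- If `t < t'`, then `τ` has at `t` the small arc moved there from `σ`, so `LargeFirst` yields a
large arc of `τ` before `t`, contradicting the choice of `t'`. -/
theorem nextLarge_le_of_borrowMap_eq {i d k t t' : V} (hσk : σ k < d) (hσi : i < σ k)
    (ht : t ∈ K) (hkt : k < t)
    (hmin' : ∀ u ∈ K, τ u < i → k < u → t' ≤ u)
    (hτ' : LargeFirst K i d τ k) (h : exch σ k t = exch τ k t') : t' ≤ t := by
  by_contra! hlt
  have h1 : τ t = σ k := by
    have := congrFun h t
    simp only [exch] at this
    grind
  obtain ⟨u, hu, h2, h3, h4⟩ := hτ' t ht hkt (by grind) (by grind)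
  have := hmin' u hu h4 h2
  grind

theorem borrowMap_injective {i d k : V} (hσk : σ k < d) (hτk : τ k < d)
    (hσi : σ k ≠ i) (hτi : τ k ≠ i)
    (hσ : i < σ k → ∃ t ∈ K, σ t < i ∧ k < t) (hτ : i < τ k → ∃ t ∈ K, τ t < i ∧ k < t)
    (hσ' : LargeFirst K i d σ k) (hτ' : LargeFirst K i d τ k)
    (h : borrowMap K i σ k = borrowMap K i τ k) : σ = τ := by
  rcases lt_or_gt_of_ne hσi with h1 | h1 <;> rcases lt_or_gt_of_ne hτi with h2 | h2
  · rwa [borrowMap_large h1, borrowMap_large h2] at h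
  · exact (borrowMap_large_ne_small h1 hτk h2 (hτ h2) hσ' h).elim
  · exact (borrowMap_large_ne_small h2 hσk h1 (hσ h1) hτ' h.symm).elim
  · obtain ⟨t, ht, hti, hkt, hmin⟩ := exists_nextLarge (hσ h1)
    obtain ⟨t', ht', hti', hkt', hmin'⟩ := exists_nextLarge (hτ h2)
    rw [borrowMap_small h1.not_gt ht hti hkt hmin,
      borrowMap_small h2.not_gt ht' hti' hkt' hmin'] at h
    have e : t = t' := le_antisymm
      (nextLarge_le_of_borrowMap_eq hτk h2 ht' hkt' hmin hσ' h.symm)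
      (nextLarge_le_of_borrowMap_eq hσk h1 ht hkt hmin' hτ' h)
    subst e
    exact exch_injective h

end Matching

section Matching

variable {V : Type*} [LinearOrder V] {K L : Finset V} {σ τ : V → V}

/-! ### The sweep of Algorithm II -/

/-- The vertices of `K` to the right of `i`. -/
abbrev after (K : Finset V) (i : V) : Finset V := K.filter fun k => i < k

/-- Borrow successively at all vertices between `i` and `j`, from right to left. -/
def sweep (K : Finset V) (i : V) (σ : V → V) (j : V) : V → V :=
  (leftwards (after K i) j).foldl (borrowMap K i) σ

/-- The invariant of `sweep` when all vertices from `j` on have been visited. -/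
structure SweepInv (K L : Finset V) (i d : V) (σ : V → V) (j : V) : Prop where
  arcMap : ArcMap K L σ
  notMem : i ∉ L
  lt : i < j
  largeFirst : ∀ k' ∈ K, j ≤ k' → i < σ k' → σ k' < d → ∃ k'' ∈ K, j ≤ k'' ∧ k'' < k' ∧ σ k'' < i
  exists_large : ∃ k ∈ K, j ≤ k ∧ σ k < i
  not_tight : ∀ k ∈ K, j ≤ k → k ≤ d → i < σ k → ∃ k' ∈ K, σ k < k' ∧ k' < k

theorem ArcMap.ne (h : ArcMap K L σ) {i k : V} (hi : i ∉ L) (hk : k ∈ K) : σ k ≠ i :=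
  fun e => hi (e ▸ h.mem hk)

theorem SweepInv.borrowMap_cases {i d j m : V} (h : SweepInv K L i d σ j) (hm : m ∈ K)
    (him : i < m) (hmj : m < j) (hmax : ∀ k ∈ K, i < k → k < j → k ≤ m) :
    (σ m < i ∧ borrowMap K i σ m = σ) ∨ ∃ t ∈ K, i < σ m ∧ j ≤ t ∧ σ t < i ∧
      (∀ t' ∈ K, σ t' < i → j ≤ t' → t ≤ t') ∧ borrowMap K i σ m = exch σ m t := by
  rcases lt_or_gt_of_ne (h.arcMap.ne h.notMem hm) with h1 | h1
  · exact Or.inl ⟨h1, borrowMap_large h1⟩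
  · obtain ⟨k, hk, h2, h3⟩ := h.exists_large
    obtain ⟨t, ht, hti, hmt, hmin⟩ := exists_nextLarge (σ := σ) (i := i) (k := m)
      ⟨k, hk, h3, by grind⟩
    refine Or.inr ⟨t, ht, h1, by grind, hti, ?_, borrowMap_small h1.not_gt ht hti hmt hmin⟩
    grind

theorem SweepInv.step {i d j m : V} (h : SweepInv K L i d σ j) (hm : m ∈ K)
    (him : i < m) (hmj : m < j) (hmax : ∀ k ∈ K, i < k → k < j → k ≤ m) (hmd : m ≤ d) :
    SweepInv K L i d (borrowMap K i σ m) m ∧ borrowMap K i σ m m < i ∧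
      ∀ k ∈ K, (borrowMap K i σ m k < d ↔ σ k < d) ∧
        (d ≤ σ k → borrowMap K i σ m k = σ k) := by
  have hlt := h.arcMap.lt m hm
  rcases h.borrowMap_cases hm him hmj hmax with ⟨h1, h2⟩ | ⟨t, ht, h1, hjt, h2, hmin, h3⟩
  · rw [h2]
    refine ⟨⟨h.arcMap, h.notMem, him, ?_, ⟨m, hm, le_rfl, h1⟩, ?_⟩, h1, by grind⟩
    · intro k hk hmk hik hkd
      exact ⟨m, hm, le_rfl, by grind, h1⟩
    · intro k hk hmk hkd hik
      exact h.not_tight k hk (by grind) hkd hik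
  · rw [h3]
    refine ⟨⟨h.arcMap.exch hm ht (by grind) (by grind), h.notMem, him, ?_,
      ⟨m, hm, le_rfl, by simp only [exch]; grind⟩, ?_⟩, by simp only [exch]; grind, ?_⟩
    · intro k hk hmk hik hkd
      exact ⟨m, hm, le_rfl, by simp only [exch] at hik; grind, by simp only [exch]; grind⟩
    · intro k hk hmk hkd hik
      simp only [exch] at hik ⊢
      by_cases hkt : k = t
      -- The arc moved up to `t` started before `m`, so `m` now lies beneath it.
      · exact ⟨m, hm, by grind, by grind⟩
      · have := h.not_tight k hk (by grind) hkd
        grind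
    · intro k hk
      simp only [exch]
      grind

theorem SweepInv.largeFirst_of_lt {i d j m : V} (h : SweepInv K L i d σ j)
    (him : i < m) (hmj : m < j) (hmax : ∀ k ∈ K, i < k → k < j → k ≤ m) :
    LargeFirst K i d σ m := by
  intro k hk hmk h1 h2
  have := h.largeFirst k hk (by grind) h1 h2
  grind

theorem SweepInv.step_injective {i d j m : V} (h : SweepInv K L i d σ j)
    (h' : SweepInv K L i d τ j) (hm : m ∈ K)
    (him : i < m) (hmj : m < j) (hmax : ∀ k ∈ K, i < k → k < j → k ≤ m) (hmd : m ≤ d)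
    (heq : borrowMap K i σ m = borrowMap K i τ m) : σ = τ := by
  obtain ⟨k, hk, h1, h2⟩ := h.exists_large
  obtain ⟨k', hk', h1', h2'⟩ := h'.exists_large
  exact borrowMap_injective (d := d) ((h.arcMap.lt m hm).trans_le hmd)
    ((h'.arcMap.lt m hm).trans_le hmd) (h.arcMap.ne h.notMem hm) (h'.arcMap.ne h.notMem hm)
    (fun _ => ⟨k, hk, h2, by grind⟩) (fun _ => ⟨k', hk', h2', by grind⟩)
    (h.largeFirst_of_lt him hmj hmax) (h'.largeFirst_of_lt him hmj hmax) heq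

theorem sweep_of_forall_not {i j : V} (h : ∀ k ∈ after K i, ¬ k < j) : sweep K i σ j = σ := by
  rw [sweep, leftwards_eq_nil h, List.foldl_nil]

theorem sweep_of_max {i j m : V} (hm : m ∈ after K i) (hmj : m < j)
    (hmax : ∀ k ∈ after K i, k < j → k ≤ m) :
    sweep K i σ j = sweep K i (borrowMap K i σ m) m := by
  rw [sweep, leftwards_eq_cons hm hmj hmax, List.foldl_cons, sweep]

/-- Only arcs starting before `d` are ever exchanged; with the absence of tight arcs up to `d`, this
later identifies the parameters from the output. -/
theorem SweepInv.sweep {i d j : V} (h : SweepInv K L i d σ j)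
    (hd : ∀ k ∈ K, i < k → k < j → k ≤ d) :
    ArcMap K L (sweep K i σ j) ∧
    (∀ k ∈ K, k ≤ d → i < sweep K i σ j k → ∃ k' ∈ K, sweep K i σ j k < k' ∧ k' < k) ∧
    (∃ k ∈ K, i < k ∧ sweep K i σ j k < i) ∧
    ∀ k ∈ K, (sweep K i σ j k < d ↔ σ k < d) ∧ (d ≤ σ k → sweep K i σ j k = σ k) := by
  induction j using leftwards_induction (after K i) generalizing σ with
  | base j hj =>
    rw [sweep_of_forall_not hj]
    refine ⟨h.arcMap, ?_, ?_, by simp⟩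
    · intro k hk hkd hik
      have := h.arcMap.lt k hk
      exact h.not_tight k hk (by grind) hkd hik
    · obtain ⟨k, hk, h1, h2⟩ := h.exists_large
      exact ⟨k, hk, h.lt.trans_le h1, h2⟩
  | step j m hm hmj hmax ih =>
    rw [sweep_of_max hm hmj hmax]
    obtain ⟨hmK, him⟩ := Finset.mem_filter.1 hm
    obtain ⟨h1, h2, h3⟩ := h.step hmK him hmj (by grind) (hd m hmK him hmj)
    obtain ⟨i1, i2, i3, i4⟩ := ih h1 (by grind)
    refine ⟨i1, i2, i3, fun k hk => ⟨(i4 k hk).1.trans (h3 k hk).1, fun hdk => ?_⟩⟩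
    rw [(i4 k hk).2, (h3 k hk).2 hdk]
    rwa [(h3 k hk).2 hdk]

theorem SweepInv.sweep_injective {i d j : V} (h : SweepInv K L i d σ j)
    (h' : SweepInv K L i d τ j) (hd : ∀ k ∈ K, i < k → k < j → k ≤ d)
    (heq : ArcDiagram.sweep K i σ j = ArcDiagram.sweep K i τ j) : σ = τ := by
  induction j using leftwards_induction (after K i) generalizing σ τ with
  | base j hj => rwa [sweep_of_forall_not hj, sweep_of_forall_not hj] at heq
  | step j m hm hmj hmax ih =>
    rw [sweep_of_max hm hmj hmax, sweep_of_max hm hmj hmax] at heq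
    obtain ⟨hmK, him⟩ := Finset.mem_filter.1 hm
    have hmax' : ∀ k ∈ K, i < k → k < j → k ≤ m := by grind
    have hmd := hd m hmK him hmj
    exact h.step_injective h' hmK him hmj hmax' hmd
      (ih (h.step hmK him hmj hmax' hmd).1 (h'.step hmK him hmj hmax' hmd).1 (by grind) heq)

theorem SweepInv.borrow_arcsOf {i d j m : V} (h : SweepInv K L i d σ j) (hm : m ∈ K)
    (him : i < m) (hmj : m < j) (hmax : ∀ k ∈ K, i < k → k < j → k ≤ m) :
    borrow (arcsOf K σ) i m = some (arcsOf K (borrowMap K i σ m)) := by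
  have hlt := h.arcMap.lt m hm
  rcases h.borrowMap_cases hm him hmj hmax with ⟨h1, h2⟩ | ⟨t, ht, h1, hjt, h2, hmin, h3⟩
  · simp [borrow, leftOf_arcsOf hm, h1, h2]
  · have hn : nextLarge (arcsOf K σ) i m = some t :=
      nextLarge_arcsOf ht h2 (by grind) (by grind)
    simp [borrow, leftOf_arcsOf hm, leftOf_arcsOf ht, h1.not_gt, hn, h3,
      exchange_two (σ := σ) hm ht (by grind) (by grind) (by grind)]

/-- The vertex at the pointer carries a large arc after every step, so swapping with the pointer is
the same as borrowing the next large arc. -/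
theorem SweepInv.stepII_arcsOf {i d j m : V} (h : SweepInv K L i d σ j) (hj : j ∈ K)
    (hji : σ j < i) (hm : m ∈ K) (him : i < m) (hmj : m < j)
    (hmax : ∀ k ∈ K, i < k → k < j → k ≤ m) :
    stepII i (arcsOf K σ, j) m = some (arcsOf K (borrowMap K i σ m), m) := by
  have hlt := h.arcMap.lt m hm
  rcases h.borrowMap_cases hm him hmj hmax with ⟨h1, h2⟩ | ⟨t, ht, h1, hjt, h2, hmin, h3⟩
  · simp [stepII, leftOf_arcsOf hm, leftOf_arcsOf hj, h1, h2]
  · obtain rfl : t = j := le_antisymm (hmin j hj hji le_rfl) hjt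
    have e : exch σ m t = exch σ t m := by
      funext k
      simp only [exch]
      grind
    simp [stepII, leftOf_arcsOf hm, leftOf_arcsOf ht, h1.not_gt, h3, e,
      exchange_two (σ := σ) ht hm (by grind) (by grind) (by grind)]

theorem SweepInv.foldlM_stepII {i d j : V} (h : SweepInv K L i d σ j) (hj : j ∈ K)
    (hji : σ j < i) (hjd : j ≤ d) :
    ∃ p, (leftwards (after K i) j).foldlM (stepII i) (arcsOf K σ, j) =
      some (arcsOf K (ArcDiagram.sweep K i σ j), p) := by
  induction j using leftwards_induction (after K i) generalizing σ with
  | base j hj' =>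
    rw [sweep_of_forall_not hj', leftwards_eq_nil hj']
    exact ⟨j, rfl⟩
  | step j m hm hmj hmax ih =>
    rw [sweep_of_max hm hmj hmax, leftwards_eq_cons hm hmj hmax]
    obtain ⟨hmK, him⟩ := Finset.mem_filter.1 hm
    have hmax' : ∀ k ∈ K, i < k → k < j → k ≤ m := by grind
    have hmd := hmj.le.trans hjd
    obtain ⟨h1, h2, -⟩ := h.step hmK him hmj hmax' hmd
    obtain ⟨p, hp⟩ := ih h1 hmK h2 hmd
    refine ⟨p, ?_⟩
    rw [List.foldlM_cons, h.stepII_arcsOf hj hji hmK him hmj hmax']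
    exact hp

end Matching

section Matching

variable {V : Type*} [LinearOrder V] {K L : Finset V} {σ τ : V → V}

/-! ### The rotation of Algorithm I -/

/-- `d < f` are two consecutive elements of `K` to the right of `i`, or `d = i` and `f` is the
first element of `K` to the right of `i`. -/
structure Gap (K L : Finset V) (i d f : V) : Prop where
  le : i ≤ d
  lt : d < f
  mem : f ∈ K
  eq_or_mem : d = i ∨ d ∈ K
  consecutive : ∀ k ∈ K, i < k → k < f → k ≤ d
  left_notMem : i ∉ L
  lower_notMem : d ∉ L
  upper_notMem : f ∉ L

/-- A step of Algorithm I: an arc starting after `f` is ignored, at an arc starting in the gap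
between `d` and `f` only the pointer moves, and any other arc is exchanged with the arc at the
pointer, whereupon a large arc is borrowed if necessary. -/
def rotateStep (K : Finset V) (i d f : V) (st : (V → V) × V) (m : V) : (V → V) × V :=
  if f < st.1 m then st
  else if d < st.1 m then (st.1, m)
  else (borrowMap K i (exch st.1 st.2 m) st.2, m)

/-- The invariant of Algorithm I when all vertices from `j` on have been visited and the pointer
is at `p`. -/
structure RotateInv (K L : Finset V) (i d f : V) (σ : V → V) (p j : V) : Prop where
  arcMap : ArcMap K L σ
  mem : p ∈ K
  le : j ≤ p
  upper_le : f ≤ j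
  lower_lt : d < σ p
  lt_upper : σ p < f
  between : ∀ k ∈ K, j ≤ k → k < p → f < σ k
  largeFirst : LargeFirst K i d σ p
  exists_large : ∃ r ∈ K, f ≤ r ∧ σ r < i ∧ ∀ k ∈ K, f ≤ k → k < j → i < σ k → σ k < d → k < r

/-- None of `i`, `d`, `f` is a left-hand endpoint, so the positions of `σ m` relative to them are
strict. `exists_large` ensures that a needed borrowing is possible. -/
theorem RotateInv.rotateStep_cases {i d f p j m : V} (g : Gap K L i d f)
    (h : RotateInv K L i d f σ p j) (hm : m ∈ K) (hfm : f ≤ m) (hmj : m < j)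
    (hmax : ∀ k ∈ K, f ≤ k → k < j → k ≤ m) :
    (f < σ m ∧ rotateStep K i d f (σ, p) m = (σ, p)) ∨
    (d < σ m ∧ σ m < f ∧ rotateStep K i d f (σ, p) m = (σ, m)) ∨
    (σ m < i ∧ rotateStep K i d f (σ, p) m = (exch σ p m, m)) ∨
    (i < σ m ∧ σ m < d ∧ ∃ t ∈ K, p < t ∧ σ t < i ∧ (∀ t' ∈ K, σ t' < i → p < t' → t ≤ t') ∧
      rotateStep K i d f (σ, p) m = (exch (exch σ p m) p t, m)) := by
  have hi := h.arcMap.ne g.left_notMem hm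
  have hd := h.arcMap.ne g.lower_notMem hm
  have hf := h.arcMap.ne g.upper_notMem hm
  have g1 := g.le
  have g2 := g.lt
  have hjp := h.le
  simp only [rotateStep]
  by_cases c1 : f < σ m
  · exact Or.inl ⟨c1, if_pos c1⟩
  rw [if_neg c1]
  by_cases c2 : d < σ m
  · exact Or.inr (Or.inl ⟨c2, by grind, if_pos c2⟩)
  rw [if_neg c2]
  by_cases c3 : σ m < i
  · refine Or.inr (Or.inr (Or.inl ⟨c3, ?_⟩))
    rw [borrowMap_large]
    simp only [exch]
    grind
  · refine Or.inr (Or.inr (Or.inr ⟨by grind, by grind, ?_⟩))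
    obtain ⟨r, hr, h1, h2, h3⟩ := h.exists_large
    have h4 := h3 m hm hfm hmj (by grind) (by grind)
    -- The arcs ending in `[j, p)` start after `f` and the arc at `p` starts in the gap, so a large
    -- arc to the right of `m` ends beyond `p`.
    have h5 : p < r := by
      have := h.between r hr
      have := h.lower_lt
      by_contra!
      grind
    obtain ⟨t, ht, hti, hpt, hmin⟩ := exists_nextLarge (σ := σ) (i := i) (k := p) ⟨r, hr, h2, h5⟩
    refine ⟨t, ht, hpt, hti, by grind, ?_⟩
    rw [borrowMap_small (t := t)]
    · simp only [exch]; grind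
    · exact ht
    · simp only [exch]; grind
    · exact hpt
    · simp only [exch]; grind

/-- After an exchange the old pointer position `p` carries a large arc, and the arcs ending strictly
between `m` and `p` start after `f`. So `p` is the new witness for both `largeFirst` and
`exists_large`. -/
theorem RotateInv.step {i d f p j m : V} (g : Gap K L i d f)
    (h : RotateInv K L i d f σ p j) (hm : m ∈ K) (hfm : f ≤ m) (hmj : m < j)
    (hmax : ∀ k ∈ K, f ≤ k → k < j → k ≤ m) :
    RotateInv K L i d f (rotateStep K i d f (σ, p) m).1 (rotateStep K i d f (σ, p) m).2 m ∧
      ∀ k ∈ K, f < (rotateStep K i d f (σ, p) m).1 k ↔ f < σ k := by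
  have g1 := g.le
  have g2 := g.lt
  have hmem := h.mem
  have hjp := h.le
  have hlow := h.lower_lt
  have hupp := h.lt_upper
  have hlt := h.arcMap.lt m hm
  have hbet := h.between
  have hlf := h.largeFirst
  obtain ⟨r, hr, r1, r2, r3⟩ := h.exists_large
  rcases h.rotateStep_cases g hm hfm hmj hmax with ⟨c, e⟩ | ⟨c, c', e⟩ | ⟨c, e⟩ |
    ⟨c, c', t, ht, hpt, hti, hmin, e⟩ <;> rw [e]
  · exact ⟨⟨h.arcMap, h.mem, by grind, hfm, h.lower_lt, h.lt_upper, by grind, h.largeFirst,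
      ⟨r, hr, r1, r2, by grind⟩⟩, by simp⟩
  · refine ⟨⟨h.arcMap, hm, le_rfl, hfm, c, c', by grind, ?_, ⟨r, hr, r1, r2, by grind⟩⟩, by simp⟩
    intro k hk hmk h1 h2
    have := hbet k hk
    obtain ⟨k', hk', h3⟩ := hlf k hk (by grind) h1 h2
    exact ⟨k', hk', by grind⟩
  · refine ⟨⟨h.arcMap.exch hmem hm (by grind) (by grind), hm, le_rfl, hfm, ?_, ?_, by grind, ?_,
      ⟨p, hmem, by grind, ?_, by grind⟩⟩, ?_⟩
    · simp only [exch]; grind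
    · simp only [exch]; grind
    · intro k hk hmk h1 h2
      have := hbet k hk
      refine ⟨p, hmem, by grind, ?_, ?_⟩ <;> simp only [exch] at h1 h2 ⊢ <;> grind
    · simp only [exch]; grind
    · simp only [exch]; grind
  · have hρ := h.arcMap.exch hmem hm (by grind) (by grind)
    refine ⟨⟨hρ.exch hmem ht ?_ ?_, hm, le_rfl, hfm, ?_, ?_, by grind, ?_,
      ⟨p, hmem, by grind, ?_, by grind⟩⟩, ?_⟩
    · simp only [exch]; grind
    · simp only [exch]; grind
    · simp only [exch]; grind
    · simp only [exch]; grind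
    · intro k hk hmk h1 h2
      have := hbet k hk
      refine ⟨p, hmem, by grind, ?_, ?_⟩ <;> simp only [exch] at h1 h2 ⊢ <;> grind
    · simp only [exch]; grind
    · simp only [exch]; grind

/-- The pointer's arc starts in the gap. For a small arc at `m`, a right-hand endpoint lies between
the two starts exactly when `σ m` is outside the gap: then `f` or `d` separates them, and in the
latter case `d ≠ i` because `i < σ m < d`. -/
theorem RotateInv.stepI_arcsOf {i d f p j m : V} (g : Gap K L i d f)
    (h : RotateInv K L i d f σ p j) (hm : m ∈ K) (hfm : f ≤ m) (hmj : m < j)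
    (hmax : ∀ k ∈ K, f ≤ k → k < j → k ≤ m) :
    stepI i (arcsOf K σ, p) m = some (arcsOf K (rotateStep K i d f (σ, p) m).1,
      (rotateStep K i d f (σ, p) m).2) := by
  have g1 := g.le
  have g2 := g.lt
  have hmem := h.mem
  have hjp := h.le
  have hlow := h.lower_lt
  have hupp := h.lt_upper
  have hlt := h.arcMap.lt m hm
  rcases h.rotateStep_cases g hm hfm hmj hmax with ⟨c, e⟩ | ⟨c, c', e⟩ | ⟨c, e⟩ |
    ⟨c, c', t, ht, hpt, hti, hmin, e⟩ <;> rw [e]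
  · have hb : HasRightBetween (arcsOf K σ) (σ p) (σ m) :=
      hasRightBetween_arcsOf.2 ⟨f, g.mem, by grind⟩
    have h1 : ¬ σ m < i := by grind
    have h2 : σ p < σ m := by grind
    simp [stepI, leftOf_arcsOf hm, leftOf_arcsOf hmem, h1, h2, hb]
  · have hb : ¬ HasRightBetween (arcsOf K σ) (σ p) (σ m) := by
      rw [hasRightBetween_arcsOf]
      rintro ⟨k, hk, h1, h2⟩
      have := g.consecutive k hk
      grind
    have h1 : ¬ σ m < i := by grind
    simp [stepI, leftOf_arcsOf hm, leftOf_arcsOf hmem, h1, hb]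
  · simp [stepI, leftOf_arcsOf hm, leftOf_arcsOf hmem, c,
      exchange_two (σ := σ) hmem hm (by grind) (by grind) (by grind)]
  · have hb : HasRightBetween (arcsOf K σ) (σ p) (σ m) :=
      hasRightBetween_arcsOf.2 ⟨d, by have := g.eq_or_mem; grind, by grind⟩
    have h1 : ¬ σ m < i := by grind
    have h2 : ¬ σ p < σ m := by grind
    have hn : nextLarge (arcsOf K σ) i p = some t := nextLarge_arcsOf ht hti hpt hmin
    simp [stepI, leftOf_arcsOf hm, leftOf_arcsOf hmem, leftOf_arcsOf ht, h1, h2, hb, hn,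
      exchange_three (σ := σ) hmem hm ht (by grind) (by grind) (by grind) (by grind) (by grind)
        (by grind)]

/-- If `p < q`, then for `τ` the arc at `p` starts after `f` and is not touched, whereas for `σ` the
step leaves at `p` an arc starting before `f`. -/
theorem RotateInv.pointer_le {i d f p q j m : V} (g : Gap K L i d f)
    (h : RotateInv K L i d f σ p j) (h' : RotateInv K L i d f τ q j)
    (hm : m ∈ K) (hfm : f ≤ m) (hmj : m < j) (hmax : ∀ k ∈ K, f ≤ k → k < j → k ≤ m)
    (hσ : ¬ f < σ m) (heq : rotateStep K i d f (σ, p) m = rotateStep K i d f (τ, q) m) :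
    q ≤ p := by
  by_contra! hpq
  have g1 := g.le
  have g2 := g.lt
  have hmem := h.mem
  have hjp := h.le
  have hlow := h.lower_lt
  have hupp := h.lt_upper
  have h1 := h'.between p hmem hjp hpq
  have h2 : (rotateStep K i d f (τ, q) m).1 p = τ p := by
    rcases h'.rotateStep_cases g hm hfm hmj hmax with ⟨c, e⟩ | ⟨c, c', e⟩ | ⟨c, e⟩ |
      ⟨c, c', t, ht, hpt, hti, hmin, e⟩ <;> rw [e] <;> simp only [exch] <;> grind
  have h3 : (rotateStep K i d f (σ, p) m).1 p < f := by
    rcases h.rotateStep_cases g hm hfm hmj hmax with ⟨c, e⟩ | ⟨c, c', e⟩ | ⟨c, e⟩ |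
      ⟨c, c', t, ht, hpt, hti, hmin, e⟩ <;> rw [e] <;> simp only [exch] <;> grind
  rw [heq, h2] at h3
  exact lt_asymm h1 h3

/-- The new pointer shows whether the arc at `m` was ignored. If it was not, the old pointers agree,
and the arc now at the old pointer shows whether a swap took place; a swap is undone by
`borrowMap_injective` and `exch_injective`. -/
theorem RotateInv.step_injective {i d f p q j m : V} (g : Gap K L i d f)
    (h : RotateInv K L i d f σ p j) (h' : RotateInv K L i d f τ q j)
    (hm : m ∈ K) (hfm : f ≤ m) (hmj : m < j) (hmax : ∀ k ∈ K, f ≤ k → k < j → k ≤ m)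
    (heq : rotateStep K i d f (σ, p) m = rotateStep K i d f (τ, q) m) :
    σ = τ ∧ p = q := by
  have g1 := g.le
  have g2 := g.lt
  have hjp := h.le
  have hjq := h'.le
  by_cases c : f < σ m
  · by_cases c' : f < τ m
    · simp only [rotateStep, if_pos c, if_pos c', Prod.mk.injEq] at heq
      exact heq
    · exfalso
      simp only [rotateStep, if_pos c, if_neg c'] at heq
      have := congrArg Prod.snd heq
      grind
  by_cases c' : f < τ m
  · exfalso
    simp only [rotateStep, if_neg c, if_pos c'] at heq
    have := congrArg Prod.snd heq
    grind
  obtain rfl : p = q := le_antisymm (h'.pointer_le g h hm hfm hmj hmax c' heq.symm)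
    (h.pointer_le g h' hm hfm hmj hmax c heq)
  refine ⟨?_, rfl⟩
  -- A swap leaves a large arc at `p`; otherwise the arc at `p` still starts in the gap.
  have key : ∀ {ρ : V → V}, RotateInv K L i d f ρ p j → ¬ f < ρ m →
      (d < ρ m ↔ d < (rotateStep K i d f (ρ, p) m).1 p) := by
    intro ρ hρ hc
    have := hρ.lower_lt
    rcases hρ.rotateStep_cases g hm hfm hmj hmax with ⟨c, e⟩ | ⟨c, c', e⟩ | ⟨c, e⟩ |
      ⟨c, c', t, ht, hpt, hti, hmin, e⟩ <;> rw [e] <;> simp only [exch] <;> grind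
  have hiff : d < σ m ↔ d < τ m := by rw [key h c, key h' c', heq]
  by_cases b : d < σ m
  · simp only [rotateStep, if_neg c, if_neg c', if_pos b, if_pos (hiff.1 b), Prod.mk.injEq] at heq
    exact heq.1
  have b' : ¬ d < τ m := fun x => b (hiff.2 x)
  simp only [rotateStep, if_neg c, if_neg c', if_neg b, if_neg b', Prod.mk.injEq] at heq
  have hlarge : ∀ {ρ : V → V}, RotateInv K L i d f ρ p j → ¬ f < ρ m → ¬ d < ρ m →
      exch ρ p m p < d ∧ exch ρ p m p ≠ i ∧
      (i < exch ρ p m p → ∃ t ∈ K, exch ρ p m t < i ∧ p < t) ∧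
      LargeFirst K i d (exch ρ p m) p := by
    intro ρ hρ hc hc'
    have e1 := hρ.arcMap.ne g.left_notMem hm
    have e2 := hρ.arcMap.ne g.lower_notMem hm
    refine ⟨by simp only [exch]; grind, by simp only [exch]; grind, fun hh => ?_, ?_⟩
    · simp only [exch] at hh
      rcases hρ.rotateStep_cases g hm hfm hmj hmax with ⟨c, e⟩ | ⟨c, c', e⟩ | ⟨c, e⟩ |
        ⟨c, c', t, ht, hpt, hti, hmin, e⟩
      · grind
      · grind
      · grind
      · exact ⟨t, ht, by simp only [exch]; grind, hpt⟩
    · intro k hk hpk h1 h2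
      have e3 : exch ρ p m k = ρ k := by simp only [exch]; grind
      rw [e3] at h1 h2
      obtain ⟨k', hk', h3, h4, h5⟩ := hρ.largeFirst k hk hpk h1 h2
      exact ⟨k', hk', h3, h4, by simp only [exch]; grind⟩
  obtain ⟨a1, a2, a3, a4⟩ := hlarge h c b
  obtain ⟨b1, b2, b3, b4⟩ := hlarge h' c' b'
  exact exch_injective (borrowMap_injective a1 b1 a2 b2 a3 b3 a4 b4 heq.1)

/-- Algorithm I, started with the pointer at `j`. -/
def rotate (K : Finset V) (i d f : V) (st : (V → V) × V) (j : V) : (V → V) × V :=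
  (leftwards (K.filter fun k => f ≤ k) j).foldl (rotateStep K i d f) st

theorem rotate_of_forall_not {i d f j : V} {st : (V → V) × V}
    (h : ∀ k ∈ K.filter (fun k => f ≤ k), ¬ k < j) : rotate K i d f st j = st := by
  rw [rotate, leftwards_eq_nil h, List.foldl_nil]

theorem rotate_of_max {i d f j m : V} {st : (V → V) × V}
    (hm : m ∈ K.filter fun k => f ≤ k) (hmj : m < j)
    (hmax : ∀ k ∈ K.filter (fun k => f ≤ k), k < j → k ≤ m) :
    rotate K i d f st j = rotate K i d f (rotateStep K i d f st m) m := by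
  rw [rotate, leftwards_eq_cons hm hmj hmax, List.foldl_cons, rotate]

theorem RotateInv.rotate {i d f p j : V} (g : Gap K L i d f) (h : RotateInv K L i d f σ p j) :
    RotateInv K L i d f (rotate K i d f (σ, p) j).1 f f ∧ (rotate K i d f (σ, p) j).2 = f ∧
      (∀ k ∈ K, f < (ArcDiagram.rotate K i d f (σ, p) j).1 k ↔ f < σ k) ∧
      (leftwards (K.filter fun k => f ≤ k) j).foldlM (stepI i) (arcsOf K σ, p) =
        some (arcsOf K (ArcDiagram.rotate K i d f (σ, p) j).1,
          (ArcDiagram.rotate K i d f (σ, p) j).2) := by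
  induction j using leftwards_induction (K.filter fun k => f ≤ k) generalizing σ p with
  | base j hj =>
    rw [rotate_of_forall_not hj, leftwards_eq_nil hj]
    have hfj : j = f := by
      have h1 := hj f (by simp [g.mem])
      exact le_antisymm (not_lt.1 h1) h.upper_le
    subst hfj
    -- Otherwise `between` applies at `f` and makes the arc ending at `f` start after `f`.
    have hp : p = j := by
      by_contra hne
      have h1 := h.le
      have h2 := h.between j g.mem le_rfl (by grind)
      have h3 := h.arcMap.lt j g.mem
      grind
    subst hp
    exact ⟨h, rfl, by simp, rfl⟩
  | step j m hm hmj hmax ih =>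
    rw [rotate_of_max hm hmj hmax, leftwards_eq_cons hm hmj hmax]
    obtain ⟨hmK, hfm⟩ := Finset.mem_filter.1 hm
    have hmax' : ∀ k ∈ K, f ≤ k → k < j → k ≤ m := by grind
    obtain ⟨h1, h2⟩ := h.step g hmK hfm hmj hmax'
    obtain ⟨i1, i2, i3, i4⟩ := ih h1
    refine ⟨i1, i2, fun k hk => (i3 k hk).trans (h2 k hk), ?_⟩
    rw [List.foldlM_cons, h.stepI_arcsOf g hmK hfm hmj hmax']
    exact i4

theorem RotateInv.rotate_injective {i d f p q j : V} (g : Gap K L i d f)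
    (h : RotateInv K L i d f σ p j) (h' : RotateInv K L i d f τ q j)
    (heq : ArcDiagram.rotate K i d f (σ, p) j = ArcDiagram.rotate K i d f (τ, q) j) :
    σ = τ ∧ p = q := by
  induction j using leftwards_induction (K.filter fun k => f ≤ k) generalizing σ τ p q with
  | base j hj =>
    rwa [rotate_of_forall_not hj, rotate_of_forall_not hj, Prod.mk.injEq] at heq
  | step j m hm hmj hmax ih =>
    rw [rotate_of_max hm hmj hmax, rotate_of_max hm hmj hmax] at heq
    obtain ⟨hmK, hfm⟩ := Finset.mem_filter.1 hm
    have hmax' : ∀ k ∈ K, f ≤ k → k < j → k ≤ m := by grind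
    obtain ⟨e1, e2⟩ := ih (h.step g hmK hfm hmj hmax').1 (h'.step g hmK hfm hmj hmax').1 heq
    exact h.step_injective g h' hmK hfm hmj hmax' (Prod.ext e1 e2)

/-- Starting further to the right makes no difference if all arcs there start in the gap or
after it. -/
theorem rotate_eq_of_forall_lt {i d f p e j : V} (he : e ∈ K) (hfe : f ≤ e) (hej : e < j)
    (hde : d < σ e) (hef : σ e < f) (h : ∀ k ∈ K, e ≤ k → d < σ k) :
    rotate K i d f (σ, p) j = rotate K i d f (σ, e) e := by
  induction j using leftwards_induction (K.filter fun k => f ≤ k) generalizing p with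
  | base j hj => exact absurd hej (hj e (by simp [he, hfe]))
  | step j m hm hmj hmax ih =>
    rw [rotate_of_max hm hmj hmax]
    have hem : e ≤ m := hmax e (by simp [he, hfe]) hej
    have hmK : m ∈ K := (Finset.mem_filter.1 hm).1
    rcases hem.eq_or_lt with rfl | hlt
    · congr 1
      simp only [rotateStep]
      rw [if_neg hef.not_gt, if_pos hde]
    · have := h m hmK hem
      simp only [rotateStep]
      split_ifs
      · exact ih hlt
      · exact ih hlt

end Matching

section Matching

variable {V : Type*} [LinearOrder V] {K L : Finset V} {σ τ ω : V → V}

/-! ### The two algorithms combined -/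

theorem ArcMap.notMem_of_mem (h : ArcMap K L σ) {k : V} (hk : k ∈ K) : k ∉ L := by
  intro hL
  rw [← h.image_eq, Finset.mem_image] at hL
  obtain ⟨k', hk', rfl⟩ := hL
  exact h.notMem k' hk' hk

/-- `ω` is the result of the two algorithms for `σ`, in the three cases that there is no critical
large arc, that there is only a critical large arc, and that there are both critical arcs. -/
inductive Outcome (K L : Finset V) (i : V) (σ ω : V → V) : Prop
  | noLarge (h : ∀ k ∈ K, i < k → i < σ k) (hω : ω = σ)
  | noSmall (d : V) (hd : d ∈ K) (hid : i < d) (hlarge : σ d < i)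
      (hclose : ∀ k ∈ K, σ k < d → k ≤ d) (hω : ω = sweep K i σ d)
  | crossing (d f c : V) (gap : Gap K L i d f) (hmax : ∀ k ∈ K, σ k < f → k ≤ c)
      (inv : RotateInv K L i d f σ c c)
      (hω : ω = sweep K i (rotate K i d f (σ, c) c).1 f)

theorem ArcMap.sweepInv (h : ArcMap K L σ) {i d : V} (hi : i ∉ L) (hd : d ∈ K) (hid : i < d)
    (hlarge : σ d < i) (hclose : ∀ k ∈ K, σ k < d → k ≤ d) : SweepInv K L i d σ d :=
  ⟨h, hi, hid, by grind, ⟨d, hd, le_rfl, hlarge⟩, by grind⟩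

theorem RotateInv.sweepInv {i d f : V} (g : Gap K L i d f) (h : RotateInv K L i d f σ f f) :
    SweepInv K L i d σ f := by
  have h1 := h.lower_lt
  obtain ⟨r, hr, h2, h3, -⟩ := h.exists_large
  refine ⟨h.arcMap, g.left_notMem, g.le.trans_lt g.lt, ?_, ⟨r, hr, h2, h3⟩, ?_⟩
  · intro k hk hfk h4 h5
    obtain ⟨k', hk', h6, h7⟩ := h.largeFirst k hk (by grind) h4 h5
    exact ⟨k', hk', h6.le, h7⟩
  · intro k hk hfk hkd
    exact absurd (hfk.trans hkd) (not_le.2 g.lt)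

/-! ### Recovering the case and its parameters from tight arcs -/

/-- The arc of `σ` at `k` starts to the right of `i`, and no element of `K` lies below it. -/
def Tight (K : Finset V) (i : V) (σ : V → V) (k : V) : Prop :=
  i < σ k ∧ ∀ k' ∈ K, σ k < k' → ¬ k' < k

theorem noSmall_spec (h : ArcMap K L σ) {i d : V} (hi : i ∉ L) (hd : d ∈ K) (hid : i < d)
    (hlarge : σ d < i) (hclose : ∀ k ∈ K, σ k < d → k ≤ d) :
    ArcMap K L (sweep K i σ d) ∧ (∃ k ∈ K, i < k ∧ sweep K i σ d k < i) ∧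
      (∀ k ∈ K, k ≤ d → ¬ Tight K i (sweep K i σ d) k) ∧
      ∀ k ∈ K, sweep K i σ d k < d → k ≤ d := by
  obtain ⟨h1, h2, h3, h4⟩ := (h.sweepInv hi hd hid hlarge hclose).sweep (by grind)
  refine ⟨h1, h3, ?_, fun k hk hkd => hclose k hk ((h4 k hk).1.1 hkd)⟩
  rintro k hk hkd ⟨t1, t2⟩
  obtain ⟨k', hk', h5, h6⟩ := h2 k hk hkd t1
  exact t2 k' hk' h5 h6

/-- Algorithm I brings an arc starting in the gap to `f`, and the sweep leaves it alone because it
starts after `d`. Nothing of `K` lies between `d` and `f`, so it is tight. Neither algorithm moves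
an arc starting after `f`. -/
theorem crossing_spec {i d f c : V} (g : Gap K L i d f) (inv : RotateInv K L i d f σ c c)
    (hω : ω = sweep K i (rotate K i d f (σ, c) c).1 f) :
    ArcMap K L ω ∧ (∃ k ∈ K, i < k ∧ ω k < i) ∧ Tight K i ω f ∧
      (∀ k ∈ K, k < f → ¬ Tight K i ω k) ∧ (∃ k ∈ K, f < k ∧ ω k < d) ∧
      ∀ k ∈ K, f < ω k ↔ f < σ k := by
  obtain ⟨h1, -, h2, -⟩ := inv.rotate g
  have gle := g.le
  have glt := g.lt
  obtain ⟨s1, s2, s3, s4⟩ := (h1.sweepInv g).sweep g.consecutive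
  rw [← hω] at s1 s2 s3 s4
  have hf := (s4 f g.mem).2 h1.lower_lt.le
  have hlow := h1.lower_lt
  have hup := h1.lt_upper
  refine ⟨s1, s3, ?_, ?_, ?_, ?_⟩
  · rw [Tight, hf]
    refine ⟨g.le.trans_lt h1.lower_lt, fun k hk hk1 hk2 => ?_⟩
    have := g.consecutive k hk (by grind) hk2
    grind
  · rintro k hk hkf ⟨t1, t2⟩
    have := s1.lt k hk
    obtain ⟨k', hk', h5, h6⟩ := s2 k hk (g.consecutive k hk (by grind) hkf) t1
    exact t2 k' hk' h5 h6
  · obtain ⟨r, hr, r1, r2, -⟩ := h1.exists_large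
    exact ⟨r, hr, by grind, (s4 r hr).1.2 (by grind)⟩
  · intro k hk
    rw [← h2 k hk]
    have := s4 k hk
    grind

/-- The first vertex of `K` beyond `d` would carry a tight arc: that arc cannot start before `d`,
and `K` has no vertex between. -/
theorem noSmall_unique {i d d' : V} (hid : i < d) (hd' : d' ∈ K)
    (hω : ArcMap K L ω) (hi : i ∉ L)
    (h2 : ∀ k ∈ K, ω k < d → k ≤ d)
    (h1' : ∀ k ∈ K, k ≤ d' → ¬ Tight K i ω k) : d' ≤ d := by
  by_contra! hlt
  obtain ⟨m, hm, hmin⟩ := (K.filter fun k => d < k).exists_minimal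
    ⟨d', by simp [hd', hlt]⟩
  rw [Finset.mem_filter] at hm
  have hmd' : m ≤ d' := by
    by_contra! hc
    exact absurd (hmin (by simp [hd', hlt]) hc.le) (not_le.2 hc)
  refine h1' m hm.1 hmd' ⟨?_, fun k hk hk1 hk2 => ?_⟩
  · have := hω.ne hi hm.1
    by_contra! hc
    exact absurd (h2 m hm.1 (hc.trans_lt hid)) (not_le.2 hm.2)
  · have h3 : k ≤ d := by
      by_contra! hc
      exact absurd (hmin (by simp [hk, hc]) hk2.le) (not_le.2 hk2)
    exact absurd (h2 m hm.1 (hk1.trans_le h3)) (not_le.2 hm.2)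

/-- Tightness at `f` forces `d < f`, and maximality gives `d' ≤ d`. The arc from before `d'` to
beyond `f` would then pass over `d`. -/
theorem noSmall_crossing_false {i d d' f : V} (hd : d ∈ K) (hid : i < d) (g : Gap K L i d' f)
    (hω : ArcMap K L ω) (h1 : ∀ k ∈ K, k ≤ d → ¬ Tight K i ω k) (h2 : ∀ k ∈ K, ω k < d → k ≤ d)
    (hf : Tight K i ω f) (hf' : ∀ k ∈ K, k < f → ¬ Tight K i ω k)
    (hk : ∃ k ∈ K, f < k ∧ ω k < d') : False := by
  have glt := g.lt
  have hdf : d < f := by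
    by_contra! hc
    exact h1 f g.mem hc hf
  have hdd := g.consecutive d hd hid hdf
  have hd' : d' ∈ K := g.eq_or_mem.resolve_left (by grind)
  have hle : d' ≤ d := noSmall_unique hid hd' hω g.left_notMem h2
    fun k hk hk' => hf' k hk (hk'.trans_lt g.lt)
  obtain ⟨k, hk, hfk, hkd⟩ := hk
  have := h2 k hk (hkd.trans_le hle)
  grind

theorem Outcome.injective {i : V} (hi : i ∉ L) (hσ : ArcMap K L σ) (hτ : ArcMap K L τ)
    (h : Outcome K L i σ ω) (h' : Outcome K L i τ ω) : σ = τ := by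
  cases h with
  | noLarge h hω =>
    subst hω
    cases h' with
    | noLarge _ hω => exact hω
    | noSmall d hd hid hlarge hclose hω =>
      subst hω
      obtain ⟨-, ⟨k, hk, h1, h2⟩, -⟩ := noSmall_spec hτ hi hd hid hlarge hclose
      exact absurd (h k hk h1) h2.not_gt
    | crossing d f c g hmax inv hω =>
      obtain ⟨-, ⟨k, hk, h1, h2⟩, -⟩ := crossing_spec g inv hω
      exact absurd (h k hk h1) h2.not_gt
  | noSmall d hd hid hlarge hclose hω =>
    obtain ⟨a1, ⟨k, hk, h1, h2⟩, a2, a3⟩ := noSmall_spec hσ hi hd hid hlarge hclose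
    rw [← hω] at a1 h2 a2 a3
    cases h' with
    | noLarge h hω =>
      subst hω
      exact absurd (h k hk h1) h2.not_gt
    | noSmall d' hd' hid' hlarge' hclose' hω' =>
      obtain ⟨b1, -, b2, b3⟩ := noSmall_spec hτ hi hd' hid' hlarge' hclose'
      rw [← hω'] at b1 b2 b3
      obtain rfl : d = d' := le_antisymm (noSmall_unique hid' hd a1 hi b3 a2)
        (noSmall_unique hid hd' a1 hi a3 b2)
      exact (hσ.sweepInv hi hd hid hlarge hclose).sweep_injective
        (hτ.sweepInv hi hd hid hlarge' hclose') (by grind) (hω ▸ hω')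
    | crossing d' f c g hmax inv hω' =>
      obtain ⟨-, -, b1, b2, b3, -⟩ := crossing_spec g inv hω'
      exact (noSmall_crossing_false hd hid g a1 a2 a3 b1 b2 b3).elim
  | crossing d f c g hmax inv hω =>
    obtain ⟨a1, ⟨k, hk, h1, h2⟩, a2, a3, a4, a5⟩ := crossing_spec g inv hω
    cases h' with
    | noLarge h hω =>
      subst hω
      exact absurd (h k hk h1) h2.not_gt
    | noSmall d' hd' hid' hlarge' hclose' hω' =>
      obtain ⟨b1, -, b2, b3⟩ := noSmall_spec hτ hi hd' hid' hlarge' hclose'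
      rw [← hω'] at b1 b2 b3
      exact (noSmall_crossing_false hd' hid' g a1 b2 b3 a2 a3 a4).elim
    | crossing d' f' c' g' hmax' inv' hω' =>
      obtain ⟨b1, -, b2, b3, b4, b5⟩ := crossing_spec g' inv' hω'
      -- Both are the first vertex at which `ω` has a tight arc.
      obtain rfl : f = f' := le_antisymm (not_lt.1 fun hc => a3 f' g'.mem hc b2)
        (not_lt.1 fun hc => b3 f g.mem hc a2)
      have hdle : ∀ {d d' : V}, Gap K L i d f → Gap K L i d' f → d ≤ d' := by
        intro d d' g g'
        rcases g.eq_or_mem with e | e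
        · exact e ▸ g'.le
        · rcases g.le.eq_or_lt with e' | e'
          · exact e' ▸ g'.le
          · exact g'.consecutive d e e' g.lt
      obtain rfl : d = d' := le_antisymm (hdle g g') (hdle g' g)
      -- The vertices whose arcs start before `f` are the same for both inputs as for `ω`, and `c`
      -- is the last of them.
      have hcle : ∀ {ρ ρ' : V → V} {c c' : V}, RotateInv K L i d f ρ c c → ArcMap K L ρ' →
          (∀ k ∈ K, ρ' k < f → k ≤ c') → (∀ k ∈ K, f < ω k ↔ f < ρ k) →
          (∀ k ∈ K, f < ω k ↔ f < ρ' k) → c ≤ c' := by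
        intro ρ ρ' c c' hinv hρ' hm e e'
        refine hm c hinv.mem ?_
        have := hρ'.ne g.upper_notMem hinv.mem
        have := (e c hinv.mem).symm.trans (e' c hinv.mem)
        have := hinv.lt_upper
        grind
      obtain rfl : c = c' := le_antisymm (hcle inv hτ hmax' a5 b5) (hcle inv' hσ hmax b5 a5)
      obtain ⟨r1, r2, -⟩ := inv.rotate g
      obtain ⟨r1', r2', -⟩ := inv'.rotate g
      have e := (r1.sweepInv g).sweep_injective (r1'.sweepInv g) g.consecutive (hω ▸ hω')
      exact (inv.rotate_injective g inv' (Prod.ext e (r2.trans r2'.symm))).1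

theorem Outcome.arcMap {i : V} (hi : i ∉ L) (hσ : ArcMap K L σ) (h : Outcome K L i σ ω) :
    ArcMap K L ω := by
  cases h with
  | noLarge _ hω => exact hω ▸ hσ
  | noSmall d hd hid hlarge hclose hω =>
    exact hω ▸ (noSmall_spec hσ hi hd hid hlarge hclose).1
  | crossing d f c g hmax inv hω => exact (crossing_spec g inv hω).1

end Matching

section Matching

variable {V : Type*} [LinearOrder V] {K L : Finset V} {σ τ ω : V → V}

/-! ### Running the algorithms -/

theorem regionR_arcsOf {i t : V} (ht : ∀ k ∈ K, k < t) :
    regionR (arcsOf K σ) i t = after K i := by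
  rw [regionR, rights_arcsOf]
  ext k
  simp only [Finset.mem_filter]
  grind

theorem criticalLarge_eq_none {i t : V} (ht : ∀ k ∈ K, k < t)
    (h : ∀ k ∈ K, i < k → i < σ k) : criticalLarge (arcsOf K σ) i t = none := by
  have : (K.filter fun k => σ k < i ∧ k ∈ after K i) = ∅ := by
    rw [Finset.filter_eq_empty_iff]
    grind
  rw [criticalLarge, regionR_arcsOf ht, rights_filter_arcsOf, this, maxOpt_empty]
  rfl

theorem criticalLarge_eq_some {i t r : V} (ht : ∀ k ∈ K, k < t) (hr : r ∈ K) (hir : i < r)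
    (hri : σ r < i) (hmax : ∀ k ∈ K, i < k → σ k < i → k ≤ r) :
    criticalLarge (arcsOf K σ) i t = some (σ r, r) := by
  have : maxOpt (K.filter fun k => σ k < i ∧ k ∈ after K i) = some r := by
    apply maxOpt_eq_some <;> grind
  rw [criticalLarge, regionR_arcsOf ht, rights_filter_arcsOf, this]
  simp [leftOf_arcsOf hr]

theorem crosses_iff {a k l r i : V} (hl : l < i) (ha : i < a) :
    Crosses (a, k) (l, r) ↔ a < r ∧ r < k := by
  simp only [Crosses]
  grind

theorem criticalSmall_eq_none {i t r : V}
    (hL : criticalLarge (arcsOf K σ) i t = some (σ r, r)) (hri : σ r < i)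
    (h : ∀ k ∈ K, i < σ k → σ k < r → k ≤ r) :
    criticalSmall (arcsOf K σ) i t = none := by
  have : (K.filter fun k => i < σ k ∧ Crosses (σ k, k) (σ r, r)) = ∅ := by
    rw [Finset.filter_eq_empty_iff]
    rintro k hk ⟨h1, h2⟩
    rw [crosses_iff hri h1] at h2
    grind
  simp [criticalSmall, hL, lefts_filter_arcsOf, this, minOpt_empty]

theorem ArcMap.criticalSmall_eq_some (hσ : ArcMap K L σ) {i t r e : V}
    (hL : criticalLarge (arcsOf K σ) i t = some (σ r, r)) (hri : σ r < i)
    (he : e ∈ K) (hie : i < σ e) (her : σ e < r) (hre : r < e)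
    (h : ∀ k ∈ K, i < σ k → σ k < r → r < k → σ e ≤ σ k) :
    criticalSmall (arcsOf K σ) i t = some (σ e, e) := by
  have : minOpt ((K.filter fun k => i < σ k ∧ Crosses (σ k, k) (σ r, r)).image σ) =
      some (σ e) := by
    apply minOpt_eq_some
    · refine Finset.mem_image_of_mem σ (Finset.mem_filter.2 ⟨he, hie, ?_⟩)
      exact (crosses_iff hri hie).2 ⟨her, hre⟩
    · intro a ha
      obtain ⟨k, hk, rfl⟩ := Finset.mem_image.1 ha
      obtain ⟨hk, h1, h2⟩ := Finset.mem_filter.1 hk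
      rw [crosses_iff hri h1] at h2
      exact h k hk h1 h2.1 h2.2
  simp [criticalSmall, hL, lefts_filter_arcsOf, this, hσ.rightOf_arcsOf he]

theorem algorithms_noLarge {i t : V} (ht : ∀ k ∈ K, k < t) (h : ∀ k ∈ K, i < k → i < σ k) :
    algorithmI (arcsOf K σ) i t = some (arcsOf K σ) ∧
      algorithmII (arcsOf K σ) i t (arcsOf K σ) = some (arcsOf K σ) := by
  have hL := criticalLarge_eq_none ht h
  have hS : criticalSmall (arcsOf K σ) i t = none := by simp [criticalSmall, hL]
  simp [algorithmI, algorithmII, hL, hS, regionR2, maxOpt_empty]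

theorem ArcMap.algorithms_noSmall (hσ : ArcMap K L σ) {i t r : V} (hi : i ∉ L)
    (ht : ∀ k ∈ K, k < t) (hr : r ∈ K) (hir : i < r) (hri : σ r < i)
    (hL : criticalLarge (arcsOf K σ) i t = some (σ r, r))
    (hclose : ∀ k ∈ K, σ k < r → k ≤ r) :
    algorithmI (arcsOf K σ) i t = some (arcsOf K σ) ∧
      algorithmII (arcsOf K σ) i t (arcsOf K σ) = some (arcsOf K (sweep K i σ r)) := by
  have hS := criticalSmall_eq_none hL hri (by grind)
  refine ⟨by simp [algorithmI, hS], ?_⟩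
  have hm : maxOpt (regionR2 (arcsOf K σ) i t) = some r := by
    simp only [regionR2, hL, hS, regionR_arcsOf ht]
    apply maxOpt_eq_some <;> grind
  obtain ⟨p, hp⟩ := (hσ.sweepInv hi hr hir hri hclose).foldlM_stepII hr hri le_rfl
  simp [algorithmII, hm, borrow, leftOf_arcsOf hr, hri, regionR_arcsOf ht, hp]

/-- Here `R₂` consists of the vertices of `K` in `(i, d]`. It is empty when `d = i`; otherwise its
maximum is `d`, and the preliminary borrowing at `d` is the first step of the sweep. -/
theorem SweepInv.algorithmII_arcsOf {i d f t e : V} {ρ : V → V} (ht : ∀ k ∈ K, k < t)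
    (g : Gap K L i d f) (h : SweepInv K L i d σ f) {x : V × V}
    (hL : criticalLarge (arcsOf K ρ) i t = some x)
    (hS : criticalSmall (arcsOf K ρ) i t = some (ρ e, e)) (hdl : d < ρ e) (hlf : ρ e < f) :
    algorithmII (arcsOf K ρ) i t (arcsOf K σ) =
      some (arcsOf K (ArcDiagram.sweep K i σ f)) := by
  have hcons := g.consecutive
  have glt := g.lt
  have gle := g.le
  rcases g.le.eq_or_lt with rfl | hid
  · have hm : maxOpt (regionR2 (arcsOf K ρ) i t) = none := by
      have : (after K i).filter (fun j => j < ρ e) = ∅ := by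
        rw [Finset.filter_eq_empty_iff]
        grind
      simp only [regionR2, hL, hS, regionR_arcsOf ht, this, maxOpt_empty]
    rw [sweep_of_forall_not (by grind)]
    simp [algorithmII, hm]
  · have hd : d ∈ K := g.eq_or_mem.resolve_left (by grind)
    have hm : maxOpt (regionR2 (arcsOf K ρ) i t) = some d := by
      simp only [regionR2, hL, hS, regionR_arcsOf ht]
      apply maxOpt_eq_some <;> grind
    have hb := h.borrow_arcsOf hd hid g.lt g.consecutive
    obtain ⟨h1, h2, -⟩ := h.step hd hid g.lt g.consecutive le_rfl
    obtain ⟨p, hp⟩ := h1.foldlM_stepII hd h2 le_rfl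
    rw [sweep_of_max (m := d) (by grind) g.lt (by grind)]
    simp [algorithmII, hm, hb, regionR_arcsOf ht, hp]

theorem ArcMap.exists_gap (hσ : ArcMap K L σ) {i r e : V} (hi : i ∉ L) (he : e ∈ K)
    (hie : i < σ e) (hr : r ∈ K) (her : σ e < r) :
    ∃ d f, Gap K L i d f ∧ d < σ e ∧ σ e < f ∧ f ≤ r ∧ ∀ k ∈ K, σ e < k → f ≤ k := by
  obtain ⟨f, hf, hfmin⟩ := Finset.exists_min_image (K.filter fun k => σ e < k) id
    ⟨r, by simp [hr, her]⟩
  -- Adjoining `i` supplies the lower end when no vertex of `K` lies between `i` and `σ e`.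
  obtain ⟨d, hd, hdmax⟩ := Finset.exists_max_image (insert i (K.filter fun k => i < k ∧ k < σ e)) id
    ⟨i, by simp⟩
  simp only [id, Finset.mem_filter, Finset.mem_insert] at hf hfmin hd hdmax
  have hfL := hσ.notMem_of_mem hf.1
  have hne := hσ.notMem e he
  refine ⟨d, f, ⟨by grind, by grind, hf.1, by grind, ?_, hi, ?_, hfL⟩, by grind, hf.2,
    by grind, by grind⟩
  · intro k hk hik hkf
    have : k ≠ σ e := fun h => hne (h ▸ hk)
    have := hfmin k
    exact hdmax k (by grind)
  · rcases hd with rfl | hd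
    · exact hi
    · exact hσ.notMem_of_mem hd.1

theorem ArcMap.exists_outcome (hσ : ArcMap K L σ) {i t : V} (hi : i ∉ L) (ht : ∀ k ∈ K, k < t) :
    ∃ ρ ω, algorithmI (arcsOf K σ) i t = some (arcsOf K ρ) ∧
      algorithmII (arcsOf K σ) i t (arcsOf K ρ) = some (arcsOf K ω) ∧ Outcome K L i σ ω := by
  by_cases hlarge : ∀ k ∈ K, i < k → i < σ k
  · obtain ⟨h1, h2⟩ := algorithms_noLarge ht hlarge
    exact ⟨σ, σ, h1, h2, .noLarge hlarge rfl⟩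
  push Not at hlarge
  obtain ⟨k₀, hk₀, hik₀, hk₀i⟩ := hlarge
  obtain ⟨r, hr, hrmax⟩ := Finset.exists_max_image (K.filter fun k => i < k ∧ σ k < i) id
    ⟨k₀, by simp [hk₀, hik₀, lt_of_le_of_ne hk₀i (hσ.ne hi hk₀)]⟩
  simp only [id, Finset.mem_filter] at hr hrmax
  obtain ⟨hr, hir, hri⟩ := hr
  have hL := criticalLarge_eq_some ht hr hir hri (by grind)
  by_cases hsmall : ∀ k ∈ K, i < σ k → σ k < r → k ≤ r
  · have hclose : ∀ k ∈ K, σ k < r → k ≤ r := by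
      intro k hk hkr
      have := hσ.ne hi hk
      have := hrmax k
      have := hsmall k hk
      grind
    obtain ⟨h1, h2⟩ := hσ.algorithms_noSmall hi ht hr hir hri hL hclose
    exact ⟨σ, _, h1, h2, .noSmall r hr hir hri hclose rfl⟩
  push Not at hsmall
  obtain ⟨k₁, hk₁, h1⟩ := hsmall
  obtain ⟨e, he, hemin⟩ := Finset.exists_min_image
    (K.filter fun k => i < σ k ∧ σ k < r ∧ r < k) σ ⟨k₁, by simp [hk₁, h1]⟩
  simp only [Finset.mem_filter] at he hemin
  obtain ⟨he, hie, her, hre⟩ := he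
  have hS := hσ.criticalSmall_eq_some hL hri he hie her hre (by grind)
  obtain ⟨d, f, g, hdl, hlf, hfr, hfmin⟩ := hσ.exists_gap hi he hie hr her
  have gle := g.le
  have glt := g.lt
  -- Such an arc is not large, by the choice of `r`. It either crosses the critical large arc, and
  -- so starts no earlier than `σ e`, or starts at or after `r`.
  have hbeyond : ∀ k ∈ K, r < k → d < σ k := by
    intro k hk hrk
    have := hσ.ne hi hk
    have := hrmax k
    have := hemin k
    grind
  -- This is used for `e`, where the algorithm starts, and for the last vertex `c` whose arc starts
  -- before `f`, which can be recovered from the output.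
  have inv : ∀ c ∈ K, r < c → σ c < f → RotateInv K L i d f σ c c := by
    intro c hc hrc hcf
    refine ⟨hσ, hc, le_rfl, by grind, hbeyond c hc hrc, hcf, by grind, ?_, r, hr, hfr, hri, ?_⟩
    · intro k hk hck h2 h3
      exact absurd (hbeyond k hk (hrc.trans hck)) h3.not_gt
    · intro k hk hfk hkc h2 h3
      have := hbeyond k hk
      grind
  obtain ⟨c, hc, hcmax⟩ := Finset.exists_max_image (K.filter fun k => σ k < f) id
    ⟨e, by simp [he, hlf]⟩
  simp only [id, Finset.mem_filter] at hc hcmax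
  obtain ⟨hc, hcf⟩ := hc
  have hec : e ≤ c := hcmax e ⟨he, hlf⟩
  have hrot : rotate K i d f (σ, c) c = rotate K i d f (σ, e) e := by
    rcases hec.eq_or_lt with rfl | hlt
    · rfl
    · exact rotate_eq_of_forall_lt he (by grind) hlt hdl hlf
        fun k hk hek => hbeyond k hk (hre.trans_le hek)
  obtain ⟨r1, -, -, r2⟩ := (inv e he hre hlf).rotate g
  refine ⟨(rotate K i d f (σ, e) e).1, sweep K i (rotate K i d f (σ, e) e).1 f, ?_,
    (r1.sweepInv g).algorithmII_arcsOf ht g hL hS hdl hlf,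
    .crossing d f c g (by grind) (inv c hc (by grind) hcf) (by rw [hrot])⟩
  have hlist : leftwards (regionR1 (arcsOf K σ) i t) e =
      leftwards (K.filter fun k => f ≤ k) e := by
    apply leftwards_congr
    intro k hke
    simp only [regionR1, hS, regionR_arcsOf ht]
    grind
  simp [algorithmI, hS, hlist, r2]

end Matching

section Matching

variable {V : Type*} [LinearOrder V] {K L : Finset V} {σ τ ω : V → V}

/-! ### The recursion -/

theorem ArcMap.erase (h : ArcMap K L σ) {t : V} (ht : t ∈ K) :
    ArcMap (K.erase t) (L.erase (σ t)) (Function.update σ t t) := by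
  have hinj := h.injOn
  have hlt := h.lt
  have hoff := h.off
  have hnot := h.notMem
  refine ⟨?_, ?_, ?_, ?_, ?_⟩
  · intro k hk; simp only [Function.update_apply]; grind
  · rw [← h.image_eq]
    ext a
    simp only [Finset.mem_image, Finset.mem_erase, Function.update_apply]
    constructor
    · rintro ⟨k, ⟨h1, h2⟩, rfl⟩
      rw [if_neg h1]
      exact ⟨fun e => h1 (hinj k h2 t ht e), k, h2, rfl⟩
    · rintro ⟨h1, k, hk, rfl⟩
      have hne : k ≠ t := fun e => h1 (e ▸ rfl)
      exact ⟨k, ⟨hne, hk⟩, if_neg hne⟩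
  · intro k hk k' hk'; simp only [Function.update_apply]; grind
  · intro k hk; simp only [Function.update_apply]; grind
  · intro k hk; simp only [Function.update_apply]; grind

theorem arcsOf_erase {t : V} :
    (arcsOf K σ).erase (σ t, t) = arcsOf (K.erase t) (Function.update σ t t) := by
  ext ⟨a, k⟩
  simp only [Finset.mem_erase, mem_arcsOf, Function.update_apply, Prod.mk.injEq, ne_eq]
  grind

theorem ArcMap.insert {t a : V} (h : ArcMap (K.erase t) (L.erase a) ω) (ht : t ∈ K) (ha : a ∈ L)
    (hat : a < t) (hdisj : ∀ k ∈ K, k ∉ L) : ArcMap K L (Function.update ω t a) := by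
  have hinj := h.injOn
  have hlt := h.lt
  have hoff := h.off
  have hmem : ∀ k ∈ K.erase t, ω k ∈ L.erase a := fun k hk => h.mem hk
  refine ⟨?_, ?_, ?_, ?_, ?_⟩
  · intro k hk; simp only [Function.update_apply]; grind
  · ext x
    simp only [Finset.mem_image, Function.update_apply]
    constructor
    · rintro ⟨k, hk, rfl⟩
      have := hmem k
      grind
    · intro hx
      by_cases hxa : x = a
      · exact ⟨t, ht, by simp [hxa]⟩
      · have : x ∈ L.erase a := by simp [hxa, hx]
        rw [← h.image_eq, Finset.mem_image] at this
        obtain ⟨k, hk, rfl⟩ := this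
        exact ⟨k, by grind, by grind⟩
  · intro k hk k' hk'
    have := hmem k
    have := hmem k'
    simp only [Function.update_apply]
    grind
  · intro k hk; simp only [Function.update_apply]; grind
  · intro k hk
    have := hmem k
    simp only [Function.update_apply]
    grind

theorem insert_arcsOf {t a : V} (ht : t ∈ K) :
    insert (a, t) (arcsOf (K.erase t) ω) = arcsOf K (Function.update ω t a) := by
  ext ⟨x, k⟩
  simp only [Finset.mem_insert, mem_arcsOf, Finset.mem_erase, Function.update_apply,
    Prod.mk.injEq]
  grind

theorem phiAux_succ_arcsOf {t : V} (ht : t ∈ K) (hmax : ∀ k ∈ K, k ≤ t)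
    {m : ℕ} {ρ : V → V} (hρ : ArcMap (K.erase t) (L.erase (σ t)) ρ)
    (h : phiAux m (arcsOf (K.erase t) (Function.update σ t t)) = some (arcsOf (K.erase t) ρ)) :
    ∃ ω, Outcome (K.erase t) (L.erase (σ t)) (σ t) ρ ω ∧
      phiAux (m + 1) (arcsOf K σ) = some (arcsOf K (Function.update ω t (σ t))) := by
  obtain ⟨ρ', ω, h1, h2, h3⟩ := hρ.exists_outcome (i := σ t) (t := t) (by simp)
    fun k hk => lt_of_le_of_ne (hmax k (Finset.mem_of_mem_erase hk)) (Finset.ne_of_mem_erase hk)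
  refine ⟨ω, h3, ?_⟩
  simp [phiAux, rights_arcsOf, maxOpt_eq_some ht hmax, leftOf_arcsOf ht, arcsOf_erase, h, h1, h2,
    insert_arcsOf ht]

/-- The induction is over all `K` and `L`, because the left-hand endpoint erased from `L` depends on
`σ`. -/
theorem phiAux_arcsOf (m : ℕ) (K L : Finset V) (hm : K.card = m) :
    (∀ σ, ArcMap K L σ → ∃ τ, ArcMap K L τ ∧ phiAux m (arcsOf K σ) = some (arcsOf K τ)) ∧
    ∀ σ σ', ArcMap K L σ → ArcMap K L σ' →
      phiAux m (arcsOf K σ) = phiAux m (arcsOf K σ') → σ = σ' := by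
  induction m generalizing K L with
  | zero =>
    refine ⟨fun σ hσ => ⟨σ, hσ, rfl⟩, fun σ σ' hσ hσ' h => ?_⟩
    exact arcsOf_inj hσ hσ' (Option.some_inj.1 h)
  | succ m ih =>
    have hne : K.Nonempty := Finset.card_pos.1 (by omega)
    obtain ⟨t, ht, hmax⟩ := Finset.exists_max_image K id hne
    simp only [id] at hmax
    have hcard : (K.erase t).card = m := by rw [Finset.card_erase_of_mem ht, hm]; rfl
    have key : ∀ σ, ArcMap K L σ → ∃ ρ ω, ArcMap (K.erase t) (L.erase (σ t)) ρ ∧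
        phiAux m (arcsOf (K.erase t) (Function.update σ t t)) = some (arcsOf (K.erase t) ρ) ∧
        Outcome (K.erase t) (L.erase (σ t)) (σ t) ρ ω ∧
        ArcMap K L (Function.update ω t (σ t)) ∧
        phiAux (m + 1) (arcsOf K σ) = some (arcsOf K (Function.update ω t (σ t))) := by
      intro σ hσ
      obtain ⟨ρ, h1, h2⟩ := (ih _ (L.erase (σ t)) hcard).1 _ (hσ.erase ht)
      obtain ⟨ω, h3, h4⟩ := phiAux_succ_arcsOf ht hmax h1 h2
      exact ⟨ρ, ω, h1, h2, h3, (h3.arcMap (by simp) h1).insert ht (hσ.mem ht) (hσ.lt t ht)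
        fun k hk => hσ.notMem_of_mem hk, h4⟩
    refine ⟨fun σ hσ => ?_, fun σ σ' hσ hσ' heq => ?_⟩
    · obtain ⟨ρ, ω, -, -, -, h4, h5⟩ := key σ hσ
      exact ⟨_, h4, h5⟩
    · obtain ⟨ρ, ω, h1, h2, h3, h4, h5⟩ := key σ hσ
      obtain ⟨ρ', ω', h1', h2', h3', h4', h5'⟩ := key σ' hσ'
      rw [h5, h5', Option.some_inj] at heq
      have hup := arcsOf_inj h4 h4' heq
      -- The arc at `t` is reinserted unchanged, so both recursive calls have the same endpoint
      -- sets.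
      have hti : σ t = σ' t := by simpa using congrFun hup t
      rw [← hti] at h1' h3' hup
      have hω : ω = ω' := by
        have e1 := (h3.arcMap (by simp) h1).off t (by simp)
        have e2 := (h3'.arcMap (by simp) h1').off t (by simp)
        funext k
        have := congrFun hup k
        simp only [Function.update_apply] at this
        by_cases hk : k = t
        · rw [hk, e1, e2]
        · simpa [hk] using this
      subst hω
      have hρ := h3.injective (by simp) h1 h1' h3'
      subst hρ
      have hers := hσ'.erase ht
      rw [← hti] at hers
      have h0 := (ih _ (L.erase (σ t)) hcard).2 _ _ (hσ.erase ht) hers (h2.trans h2'.symm)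
      funext k
      by_cases hk : k = t
      · rw [hk, hti]
      · have := congrFun h0 k
        simpa [Function.update_apply, hk] using this

/-! ### Matchings as sets of arcs -/

/-- `M` is a matching with left-hand endpoints `L` and right-hand endpoints `K`. -/
def IsMatching (K L : Finset V) (M : Finset (V × V)) : Prop :=
  ∃ σ, ArcMap K L σ ∧ M = arcsOf K σ

theorem isMatching_iff {M : Finset (V × V)} :
    IsMatching K L M ↔ rights M = K ∧ lefts M = L ∧ Disjoint K L ∧ (∀ e ∈ M, e.1 < e.2) ∧
      (∀ e ∈ M, ∀ e' ∈ M, e.1 = e'.1 → e.2 = e'.2) ∧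
      ∀ e ∈ M, ∀ e' ∈ M, e.2 = e'.2 → e.1 = e'.1 := by
  constructor
  · rintro ⟨σ, h, rfl⟩
    refine ⟨rights_arcsOf, lefts_arcsOf.trans h.image_eq,
      Finset.disjoint_left.2 fun k hk => h.notMem_of_mem hk, ?_, ?_, ?_⟩
    · rintro ⟨a, b⟩ he
      obtain ⟨hb, hab⟩ := mem_arcsOf.1 he
      exact hab ▸ h.lt b hb
    · intro e he e' he' heq
      obtain ⟨h1, h2⟩ := mem_arcsOf.1 he
      obtain ⟨h3, h4⟩ := mem_arcsOf.1 he'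
      exact h.injOn _ h1 _ h3 (by rw [h2, h4, heq])
    · intro e he e' he' heq
      rw [← (mem_arcsOf.1 he).2, ← (mem_arcsOf.1 he').2, heq]
  · rintro ⟨rfl, rfl, hdisj, hlt, hleft, hright⟩
    have hex : ∀ k, ∃ a, (k ∈ rights M → (a, k) ∈ M) ∧ (k ∉ rights M → a = k) := by
      intro k
      by_cases hk : k ∈ rights M
      · obtain ⟨⟨a, b⟩, he, rfl⟩ := Finset.mem_image.1 hk
        exact ⟨a, fun _ => he, fun h => absurd hk h⟩
      · exact ⟨k, fun h => absurd h hk, fun _ => rfl⟩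
    choose σ hσ hoff using hex
    have hM : ∀ e : V × V, e ∈ M → e.2 ∈ rights M ∧ σ e.2 = e.1 := fun e he => by
      have h1 : e.2 ∈ rights M := Finset.mem_image_of_mem _ he
      exact ⟨h1, hright _ (hσ _ h1) _ he rfl⟩
    refine ⟨σ, ⟨fun k hk => hlt _ (hσ k hk), ?_, ?_, hoff, ?_⟩, ?_⟩
    · ext a
      simp only [lefts, Finset.mem_image]
      constructor
      · rintro ⟨k, hk, rfl⟩
        exact ⟨_, hσ k hk, rfl⟩
      · rintro ⟨e, he, rfl⟩
        exact ⟨e.2, hM e he⟩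
    · intro k hk k' hk' heq
      exact hleft _ (hσ k hk) _ (hσ k' hk') heq
    · intro k hk hmem
      exact Finset.disjoint_left.1 hdisj hmem (Finset.mem_image_of_mem Prod.fst (hσ k hk))
    · ext e
      rw [mem_arcsOf]
      refine ⟨hM e, fun ⟨h1, h2⟩ => ?_⟩
      have := hσ e.2 h1
      rwa [h2] at this

theorem IsMatching.phiMatching {M : Finset (V × V)} (h : IsMatching K L M) :
    ∃ M', IsMatching K L M' ∧ phiMatching M = some M' := by
  obtain ⟨σ, hσ, rfl⟩ := h
  have hcard : (arcsOf K σ).card = K.card :=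
    Finset.card_image_of_injective _ fun a b hab => congrArg Prod.snd hab
  obtain ⟨τ, h1, h2⟩ := (phiAux_arcsOf _ K L rfl).1 σ hσ
  exact ⟨_, ⟨τ, h1, rfl⟩, by rw [ArcDiagram.phiMatching, hcard, h2]⟩

theorem IsMatching.phiMatching_injective {M M' : Finset (V × V)} (h : IsMatching K L M)
    (h' : IsMatching K L M') (heq : ArcDiagram.phiMatching M = ArcDiagram.phiMatching M') :
    M = M' := by
  obtain ⟨σ, hσ, rfl⟩ := h
  obtain ⟨τ, hτ, rfl⟩ := h'
  have hcard : ∀ ρ : V → V, (arcsOf K ρ).card = K.card := fun ρ =>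
    Finset.card_image_of_injective _ fun a b hab => congrArg Prod.snd hab
  rw [ArcDiagram.phiMatching, ArcDiagram.phiMatching, hcard, hcard] at heq
  rw [(phiAux_arcsOf _ K L rfl).2 σ τ hσ hτ heq]

end Matching

section Partition

variable {n : ℕ}

/-! ### Set partitions -/

theorem mem_part_comm (P : SetPartition n) {x y : Fin n} : x ∈ P.part y ↔ y ∈ P.part x := by
  rw [P.mem_part_iff_part_eq_part (by simp) (by simp),
    P.mem_part_iff_part_eq_part (by simp) (by simp), eq_comm]

theorem mem_part_trans (P : SetPartition n) {x y z : Fin n} (h : y ∈ P.part x)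
    (h' : z ∈ P.part y) : z ∈ P.part x := by
  rw [P.mem_part_iff_part_eq_part (by simp) (by simp)] at *
  exact h'.trans h

theorem exists_part_iff (P : SetPartition n) {x : Fin n} {p : Finset (Fin n) → Prop} :
    (∃ B ∈ P.parts, x ∈ B ∧ p B) ↔ p (P.part x) := by
  constructor
  · rintro ⟨B, hB, hx, h⟩
    rwa [P.part_eq_of_mem hB hx]
  · exact fun h => ⟨P.part x, P.part_mem.2 (by simp), P.mem_part (by simp), h⟩

theorem mem_minElems {P : SetPartition n} {x : Fin n} :
    x ∈ minElems P ↔ ∀ y ∈ P.part x, x ≤ y := by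
  simp only [minElems, Finset.mem_filter, Finset.mem_univ, true_and]
  exact exists_part_iff P (p := fun B => ∀ y ∈ B, x ≤ y)

theorem mem_maxElems {P : SetPartition n} {x : Fin n} :
    x ∈ maxElems P ↔ ∀ y ∈ P.part x, y ≤ x := by
  simp only [maxElems, Finset.mem_filter, Finset.mem_univ, true_and]
  exact exists_part_iff P (p := fun B => ∀ y ∈ B, y ≤ x)

theorem mem_arcs {P : SetPartition n} {a b : Fin n} :
    (a, b) ∈ arcs P ↔ b ∈ P.part a ∧ a < b ∧ ∀ x ∈ P.part a, ¬ (a < x ∧ x < b) := by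
  simp only [arcs, Finset.mem_filter, Finset.mem_univ, true_and]
  exact exists_part_iff P (p := fun B => b ∈ B ∧ a < b ∧ ∀ x ∈ B, ¬ (a < x ∧ x < b))

theorem exists_arc_ending {P : SetPartition n} {x y : Fin n} (hx : x ∈ P.part y) (hxy : x < y) :
    ∃ a, x ≤ a ∧ (a, y) ∈ arcs P := by
  obtain ⟨a, ha, hmax⟩ := Finset.exists_max_image ((P.part y).filter fun z => z < y) id
    ⟨x, by simp [hx, hxy]⟩
  simp only [id, Finset.mem_filter] at ha hmax
  refine ⟨a, hmax x ⟨hx, hxy⟩, mem_arcs.2 ⟨(mem_part_comm P).1 ha.1, ha.2, ?_⟩⟩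
  rintro z hz ⟨h1, h2⟩
  exact absurd (hmax z ⟨mem_part_trans P ha.1 hz, h2⟩) (not_le.2 h1)

theorem exists_arc_starting {P : SetPartition n} {x y : Fin n} (hy : y ∈ P.part x) (hxy : x < y) :
    ∃ b, (x, b) ∈ arcs P := by
  obtain ⟨b, hb, hmin⟩ := Finset.exists_min_image ((P.part x).filter fun z => x < z) id
    ⟨y, by simp [hy, hxy]⟩
  simp only [id, Finset.mem_filter] at hb hmin
  refine ⟨b, mem_arcs.2 ⟨hb.1, hb.2, ?_⟩⟩
  rintro z hz ⟨h1, h2⟩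
  exact absurd (hmin z ⟨hz, h1⟩) (not_le.2 h2)

theorem rights_arcs (P : SetPartition n) : rights (arcs P) = (minElems P)ᶜ := by
  ext b
  simp only [rights, Finset.mem_image, Finset.mem_compl, mem_minElems, Prod.exists,
    exists_eq_right]
  push Not
  constructor
  · rintro ⟨a, h⟩
    obtain ⟨h1, h2, -⟩ := mem_arcs.1 h
    exact ⟨a, (mem_part_comm P).1 h1, h2⟩
  · rintro ⟨x, hx, hxb⟩
    obtain ⟨a, -, ha⟩ := exists_arc_ending hx hxb
    exact ⟨a, ha⟩

theorem lefts_arcs (P : SetPartition n) : lefts (arcs P) = (maxElems P)ᶜ := by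
  ext a
  simp only [lefts, Finset.mem_image, Finset.mem_compl, mem_maxElems, Prod.exists,
    exists_and_right, exists_eq_right]
  push Not
  constructor
  · rintro ⟨b, h⟩
    obtain ⟨h1, h2, -⟩ := mem_arcs.1 h
    exact ⟨b, h1, h2⟩
  · rintro ⟨y, hy, hay⟩
    exact exists_arc_starting hy hay

theorem arcs_left_unique {P : SetPartition n} {a b b' : Fin n} (h : (a, b) ∈ arcs P)
    (h' : (a, b') ∈ arcs P) : b = b' := by
  obtain ⟨h1, h2, h3⟩ := mem_arcs.1 h
  obtain ⟨h1', h2', h3'⟩ := mem_arcs.1 h'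
  have := h3 b' h1'
  have := h3' b h1
  grind

theorem arcs_right_unique {P : SetPartition n} {a a' b : Fin n} (h : (a, b) ∈ arcs P)
    (h' : (a', b) ∈ arcs P) : a = a' := by
  obtain ⟨h1, h2, h3⟩ := mem_arcs.1 h
  obtain ⟨h1', h2', h3'⟩ := mem_arcs.1 h'
  have := h3 a' (mem_part_trans P h1 ((mem_part_comm P).1 h1'))
  have := h3' a (mem_part_trans P h1' ((mem_part_comm P).1 h1))
  grind

/-- Within a block, the larger of two elements is linked to the smaller by descending along the arcs
that end there. Hence the arcs determine the partition. -/
theorem mem_part_iff_eqvGen {P : SetPartition n} {x y : Fin n} :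
    y ∈ P.part x ↔ Relation.EqvGen (fun a b => (a, b) ∈ arcs P) x y := by
  constructor
  · have key : ∀ y x : Fin n, x ≤ y → y ∈ P.part x →
        Relation.EqvGen (fun a b => (a, b) ∈ arcs P) x y := by
      intro y
      induction y using WellFoundedLT.induction with
      | _ y ih =>
        intro x hxy hy
        rcases hxy.eq_or_lt with rfl | hlt
        · exact .refl _
        · obtain ⟨a, hxa, ha⟩ := exists_arc_ending ((mem_part_comm P).1 hy) hlt
          obtain ⟨h1, h2, -⟩ := mem_arcs.1 ha
          exact .trans _ _ _
            (ih a h2 x hxa (mem_part_trans P hy ((mem_part_comm P).1 h1))) (.rel _ _ ha)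
    intro h
    rcases le_total x y with hxy | hxy
    · exact key y x hxy h
    · exact .symm _ _ (key x y hxy ((mem_part_comm P).1 h))
  · intro h
    induction h with
    | rel x y h => exact (mem_arcs.1 h).1
    | refl x => exact P.mem_part (by simp)
    | symm x y _ ih => exact (mem_part_comm P).1 ih
    | trans x y z _ _ ih1 ih2 => exact mem_part_trans P ih1 ih2

theorem arcs_injective : Function.Injective (arcs (n := n)) := by
  intro P Q h
  have hpart : ∀ x, P.part x = Q.part x := by
    intro x
    ext y
    rw [mem_part_iff_eqvGen, mem_part_iff_eqvGen, h]
  have hsub : ∀ P Q : SetPartition n, (∀ x, P.part x = Q.part x) → P.parts ⊆ Q.parts := by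
    intro P Q h B hB
    obtain ⟨x, hx⟩ := P.nonempty_of_mem_parts hB
    rw [← P.part_eq_of_mem hB hx, h x]
    exact Q.part_mem.2 (by simp)
  exact Finpartition.ext ((hsub P Q hpart).antisymm (hsub Q P fun x => (hpart x).symm))

/-! ### Passage between set partitions and matchings -/

/-- The vertices `i⁰` with `i ∉ S`. -/
def rightVertices (S : Finset (Fin n)) : Finset (SplitVertex n) := Sᶜ.image fun x => toLex (x, 0)

/-- The vertices `i¹` with `i ∉ T`. -/
def leftVertices (T : Finset (Fin n)) : Finset (SplitVertex n) := Tᶜ.image fun x => toLex (x, 1)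

theorem toLex_pair_inj {a b : Fin n} {u v : Fin 2} :
    (toLex (a, u) : SplitVertex n) = toLex (b, v) ↔ a = b ∧ u = v := by
  rw [toLex_inj, Prod.mk.injEq]

theorem toLex_one_lt_toLex_zero {a b : Fin n} :
    (toLex (a, 1) : SplitVertex n) < toLex (b, 0) ↔ a < b := by
  rw [Prod.Lex.toLex_lt_toLex]
  simp

theorem mem_toMatching {P : SetPartition n} {a b : Fin n} :
    (toLex (a, 1), toLex (b, 0)) ∈ toMatching P ↔ (a, b) ∈ arcs P := by
  simp only [toMatching, Finset.mem_image, Prod.mk.injEq, toLex_pair_inj, and_true, Prod.exists]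
  grind

theorem toMatching_injective : Function.Injective (toMatching (n := n)) := by
  intro P Q h
  apply arcs_injective
  ext ⟨a, b⟩
  rw [← mem_toMatching, ← mem_toMatching, h]

theorem rights_toMatching (P : SetPartition n) :
    rights (toMatching P) = rightVertices (minElems P) := by
  rw [rightVertices, ← rights_arcs, rights, rights, toMatching, Finset.image_image,
    Finset.image_image]
  rfl

theorem lefts_toMatching (P : SetPartition n) :
    lefts (toMatching P) = leftVertices (maxElems P) := by
  rw [leftVertices, ← lefts_arcs, lefts, lefts, toMatching, Finset.image_image,
    Finset.image_image]
  rfl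

theorem disjoint_rightVertices_leftVertices (S T : Finset (Fin n)) :
    Disjoint (rightVertices S) (leftVertices T) := by
  rw [Finset.disjoint_left]
  intro x hx hx'
  obtain ⟨a, -, rfl⟩ := Finset.mem_image.1 hx
  obtain ⟨b, -, h⟩ := Finset.mem_image.1 hx'
  simp at h

theorem isMatching_toMatching (P : SetPartition n) :
    IsMatching (rightVertices (minElems P)) (leftVertices (maxElems P)) (toMatching P) := by
  rw [isMatching_iff]
  refine ⟨rights_toMatching P, lefts_toMatching P, disjoint_rightVertices_leftVertices _ _,
    ?_, ?_, ?_⟩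
  · intro e he
    obtain ⟨⟨a, b⟩, h, rfl⟩ := Finset.mem_image.1 he
    exact toLex_one_lt_toLex_zero.2 (mem_arcs.1 h).2.1
  · intro e he e' he' heq
    obtain ⟨⟨a, b⟩, h, rfl⟩ := Finset.mem_image.1 he
    obtain ⟨⟨a', b'⟩, h', rfl⟩ := Finset.mem_image.1 he'
    obtain rfl : a = a' := (toLex_pair_inj.1 heq).1
    exact toLex_pair_inj.2 ⟨arcs_left_unique h h', rfl⟩
  · intro e he e' he' heq
    obtain ⟨⟨a, b⟩, h, rfl⟩ := Finset.mem_image.1 he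
    obtain ⟨⟨a', b'⟩, h', rfl⟩ := Finset.mem_image.1 he'
    obtain rfl : b = b' := (toLex_pair_inj.1 heq).1
    exact toLex_pair_inj.2 ⟨arcs_right_unique h h', rfl⟩

/-- In a graph on a linear order whose edges increase, with at most one edge leaving and at most
one edge entering each vertex, the components are increasing paths. -/
theorem reflTransGen_of_eqvGen {α : Type*} [LinearOrder α] {r : α → α → Prop}
    (hlt : ∀ a b, r a b → a < b) (hright : ∀ a b c, r a b → r a c → b = c)
    (hleft : ∀ a b c, r a c → r b c → a = b) {x y : α} (h : Relation.EqvGen r x y)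
    (hxy : x ≤ y) : Relation.ReflTransGen r x y := by
  have hle : ∀ {a b}, Relation.ReflTransGen r a b → a ≤ b := by
    intro a b hab
    induction hab with
    | refl => exact le_rfl
    | tail _ h ih => exact ih.trans (hlt _ _ h).le
  have hor : Relation.ReflTransGen r x y ∨ Relation.ReflTransGen r y x := by
    clear hxy
    induction h with
    | rel x y h => exact Or.inl (.single h)
    | refl x => exact Or.inl .refl
    | symm x y _ ih => exact ih.symm
    | trans x y z _ _ ih1 ih2 =>
      rcases ih1 with h1 | h1 <;> rcases ih2 with h2 | h2
      · exact Or.inl (h1.trans h2)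
      · rw [← Relation.reflTransGen_swap] at h1 h2
        have := Relation.ReflTransGen.total_of_right_unique
          (fun a b c h h' => hleft b c a h h') h1 h2
        exact this.symm.imp Relation.reflTransGen_swap.1 Relation.reflTransGen_swap.1
      · exact Relation.ReflTransGen.total_of_right_unique
          (fun a b c h h' => hright a b c h h') h1 h2
      · exact Or.inr (h2.trans h1)
  rcases hor with h | h
  · exact h
  · obtain rfl := le_antisymm hxy (hle h)
    exact .refl

/-- After `i⁰` and `i¹` are identified, each vertex has at most one edge to each side, so components
are increasing paths. Consecutive elements of a block are therefore exactly the edges. -/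
theorem IsMatching.toMatching_ofMatching {S T : Finset (Fin n)}
    {M : Finset (SplitVertex n × SplitVertex n)}
    (h : IsMatching (rightVertices S) (leftVertices T) M) : toMatching (ofMatching M) = M := by
  obtain ⟨hK, hL, -, hlt, hleft, hright⟩ := isMatching_iff.1 h
  have hform : ∀ e ∈ M, ∃ a b : Fin n, e = (toLex (a, 1), toLex (b, 0)) := by
    rintro ⟨x, y⟩ he
    have h1 : x ∈ leftVertices T := hL ▸ Finset.mem_image_of_mem Prod.fst he
    have h2 : y ∈ rightVertices S := hK ▸ Finset.mem_image_of_mem Prod.snd he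
    obtain ⟨a, -, rfl⟩ := Finset.mem_image.1 h1
    obtain ⟨b, -, rfl⟩ := Finset.mem_image.1 h2
    exact ⟨a, b, rfl⟩
  set r : Fin n → Fin n → Prop := fun a b => ∃ e ∈ M, (ofLex e.1).1 = a ∧ (ofLex e.2).1 = b
    with hr
  have hrM : ∀ a b, r a b ↔ (toLex (a, 1), toLex (b, 0)) ∈ M := by
    intro a b
    constructor
    · rintro ⟨e, he, rfl, rfl⟩
      obtain ⟨a, b, rfl⟩ := hform e he
      exact he
    · exact fun he => ⟨_, he, rfl, rfl⟩
  have hrlt : ∀ a b, r a b → a < b := fun a b hab =>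
    toLex_one_lt_toLex_zero.1 (hlt _ ((hrM a b).1 hab))
  have hru : ∀ a b c, r a b → r a c → b = c := fun a b c hab hac =>
    (toLex_pair_inj.1 (hleft _ ((hrM a b).1 hab) _ ((hrM a c).1 hac) rfl)).1
  have hrl : ∀ a b c, r a c → r b c → a = b := fun a b c hac hbc =>
    (toLex_pair_inj.1 (hright _ ((hrM a c).1 hac) _ ((hrM b c).1 hbc) rfl)).1
  have hpart : ∀ x y, y ∈ (ofMatching M).part x ↔ Relation.EqvGen r x y := by
    intro x y
    classical
    rw [ofMatching]
    exact Finpartition.mem_part_ofSetoid_iff_rel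
  have hle : ∀ {a b}, Relation.ReflTransGen r a b → a ≤ b := by
    intro a b hab
    induction hab with
    | refl => exact le_rfl
    | tail _ h ih => exact ih.trans (hrlt _ _ h).le
  have harcs : ∀ a b, (a, b) ∈ arcs (ofMatching M) ↔ r a b := by
    intro a b
    rw [mem_arcs]
    simp only [hpart]
    constructor
    · rintro ⟨h1, h2, h3⟩
      have h4 := reflTransGen_of_eqvGen hrlt hru hrl h1 h2.le
      rcases Relation.ReflTransGen.cases_head h4 with h5 | ⟨c, hac, hcb⟩
      · exact absurd h5 h2.ne
      · have h6 := h3 c (.rel _ _ hac)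
        have h7 := hle hcb
        have h8 := hrlt a c hac
        obtain rfl : c = b := by grind
        exact hac
    · intro hab
      refine ⟨.rel _ _ hab, hrlt a b hab, ?_⟩
      rintro x hx ⟨h1, h2⟩
      have h4 := reflTransGen_of_eqvGen hrlt hru hrl hx h1.le
      rcases Relation.ReflTransGen.cases_head h4 with h5 | ⟨c, hac, hcx⟩
      · exact absurd h5 h1.ne
      · obtain rfl := hru a b c hab hac
        exact absurd (hle hcx) (not_le.2 h2)
  ext e
  constructor
  · intro he
    obtain ⟨⟨a, b⟩, hab, rfl⟩ := Finset.mem_image.1 he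
    exact (hrM a b).1 ((harcs a b).1 hab)
  · intro he
    obtain ⟨a, b, rfl⟩ := hform e he
    exact mem_toMatching.2 ((harcs a b).2 ((hrM a b).2 he))

theorem rightVertices_injective : Function.Injective (rightVertices (n := n)) := by
  intro S S' h
  have := Finset.image_injective (fun a b hab => (toLex_pair_inj.1 hab).1) h
  exact compl_injective this

theorem leftVertices_injective : Function.Injective (leftVertices (n := n)) := by
  intro S S' h
  have := Finset.image_injective (fun a b hab => (toLex_pair_inj.1 hab).1) h
  exact compl_injective this

theorem IsMatching.ofMatching_mem {S T : Finset (Fin n)}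
    {M : Finset (SplitVertex n × SplitVertex n)}
    (h : IsMatching (rightVertices S) (leftVertices T) M) :
    ofMatching M ∈ partitionsST S T := by
  obtain ⟨hK, hL, -⟩ := isMatching_iff.1 h
  have e := h.toMatching_ofMatching
  refine ⟨rightVertices_injective ?_, leftVertices_injective ?_⟩
  · rw [← rights_toMatching, e, hK]
  · rw [← lefts_toMatching, e, hL]

end Partition

end ArcDiagram

/-! ### The main theorem -/

theorem mainTheorem5 (n : ℕ) (S T : Finset (Fin n)) (hST : S.card = T.card) :
    ∃ Φ : ArcDiagram.partitionsST S T → ArcDiagram.partitionsST S T,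
      (∀ P, ArcDiagram.phi P.1 = some (Φ P).1) ∧
      (∀ P, ArcDiagram.phiMatching (ArcDiagram.toMatching P.1) =
        some (ArcDiagram.toMatching (Φ P).1)) ∧
      (∀ P, ArcDiagram.lefts (ArcDiagram.arcs (Φ P).1) = ArcDiagram.lefts (ArcDiagram.arcs P.1) ∧
        ArcDiagram.rights (ArcDiagram.arcs (Φ P).1) = ArcDiagram.rights (ArcDiagram.arcs P.1)) ∧
      Function.Bijective Φ := by
  have hmatch : ∀ P : ArcDiagram.partitionsST S T, ArcDiagram.IsMatching
      (ArcDiagram.rightVertices S) (ArcDiagram.leftVertices T) (ArcDiagram.toMatching P.1) := by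
    rintro ⟨P, rfl, rfl⟩
    exact ArcDiagram.isMatching_toMatching P
  choose M hM hphi using fun P => (hmatch P).phiMatching
  refine ⟨fun P => ⟨ArcDiagram.ofMatching (M P), (hM P).ofMatching_mem⟩, fun P => ?_, fun P => ?_,
    fun P => ?_, Finite.injective_iff_bijective.1 fun P Q hPQ => ?_⟩
  · rw [ArcDiagram.phi, hphi P, Option.map_some]
  · rw [hphi P, (hM P).toMatching_ofMatching]
  · have h := (hM P).ofMatching_mem
    rw [ArcDiagram.lefts_arcs, ArcDiagram.lefts_arcs, ArcDiagram.rights_arcs,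
      ArcDiagram.rights_arcs, h.1, h.2, P.2.1, P.2.2]
    exact ⟨rfl, rfl⟩
  · have h := congrArg (fun R => ArcDiagram.toMatching R.1) hPQ
    simp only [(hM P).toMatching_ofMatching, (hM Q).toMatching_ofMatching] at h
    refine Subtype.ext (ArcDiagram.toMatching_injective ?_)
    exact (hmatch P).phiMatching_injective (hmatch Q) (by rw [hphi P, hphi Q, h])
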